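/- Let $n,m\ge 1$ and $\mathbf R^{1+n}_+=\{(t,x): t>0,\ x\in\mathbf R^n\}$. All functions $f$ below are measurable functions $\mathbf R^{1+n}_+\to\mathbf C^{(1+n)m}$. For $t>0$ put $W(t,x)=\{(s,y): 1/2<s/t<2,\ |y-x|<t\}$, $W_2f(t,x)=t^{-(1+n)/2}\|f\|_{L_2(W(t,x))}$ and $W_\infty g(t,x)=\|g\|_{L_\infty(W(t,x))}$. For $g\colon\mathbf R^{1+n}_+\to[0,\infty]$ and $x\in\mathbf R^n$ put $$Ng(x)=\sup_{|y-x|<s}g(s,y),\qquad Cg(x)=\sup_{r>0}r^{-n}\iint_{s>0,\ |y-x|<r-s}g(s,y)\,ds\,dy,\qquad Ag(x)=\iint_{|y-x|<s}g(s,y)s^{-n}\,ds\,dy.$$ Let $N_{2,2}$ be the space of all $f$ with $\|f\|_{N_{2,2}}=\|N(W_2f)\|_{L_2(\mathbf R^n)}<\infty$; let $C_{2,2}$ be the space of all $f$ with $\|f\|_{C_{2,2}}<\infty$, where $\|f\|_{C_{2,2}}$ denotes either $\|C(W_2f)\|_{L_2(\mathbf R^n)}$ or the equivalent norm $\|A(W_2f)\|_{L_2(\mathbf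 R^n)}$ (the result holds for each choice); and let $L_2(t^{\alpha})$ be the space of all $f$ with $\|f\|_{L_2(t^\alpha)}^2=\iint|f(t,x)|^2t^\alpha\,dt\,dx<\infty$. For a measurable $\mathcal E\colon\mathbf R^{1+n}_+\to\mathcal L(\mathbf C^{(1+n)m})$, acting by $(\mathcal Ef)(t,x)=\mathcal E(t,x)f(t,x)$, let $|\mathcal E(t,x)|$ be the operator norm and define the Carleson--Dahlberg norm $$\|\mathcal E\|_*=\big\|C\big(W_\infty(|\mathcal E|^2/t)\big)\big\|_{L_\infty(\mathbf R^n)}^{1/2}.$$ Theorem 2.4. For every measurable $\mathcal E$ the following are equivalent: (i) $\mathcal E$ is bounded $N_{2,2}\to L_2(t^{-1})$; (ii) $\mathcal E$ is bounded $L_2(t)\to C_{2,2}$; (iii) $\|\mathcal E\|_*<\infty$. Moreover $$\|\mathcal E\|_*\approx\sup_{\|f\|_{N_{2,2}}=1}\|\mathcal Ef\|_{L_2(t^{-1})}\approx\sup_{\|f\|_{L_2(t)}=1}\|\mathcal Ef\|_{C_{2,2}},$$ where the quantities take values in $[0,\infty]$ and the implied constants depend only on $n$ and $m$, not on $\mathcal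 E$. -/

import Mathlib

open MeasureTheory
open scoped ENNReal NNReal

noncomputable section

namespace CarlesonMult

/-- The space `ℝ × ℝⁿ` of points `(t, x)`, with the Euclidean norm on `ℝⁿ`. -/
abbrev Pt (n : ℕ) : Type := ℝ × EuclideanSpace ℝ (Fin n)

/-- The range `ℂ^{(1+n)m}` of the functions, with its Euclidean norm. -/
abbrev Val (n m : ℕ) : Type := EuclideanSpace ℂ (Fin ((1 + n) * m))

/-- The open upper half space `t > 0`. Functions on it are represented by functions on `Pt n`
whose values at `t ≤ 0` play no role. -/
def halfSpace (n : ℕ) : Set (Pt n) := {p | 0 < p.1}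

/-- Lebesgue measure `dt dx` on the upper half space. -/
def halfVol (n : ℕ) : Measure (Pt n) := volume.restrict (halfSpace n)

/-- The Whitney region `W(t,x) = {(s,y) : 1/2 < s/t < 2, |y - x| < t}`. -/
def whitney {n : ℕ} (p : Pt n) : Set (Pt n) :=
  {q | 1 / 2 < q.1 / p.1 ∧ q.1 / p.1 < 2 ∧ ‖q.2 - p.2‖ < p.1}

/-- The `L_2` Whitney average `W_2 f(t,x) = t^{-(1+n)/2} ‖f‖_{L_2(W(t,x))}`, for `t > 0`. -/
def whitneyTwo {n : ℕ} {F : Type*} [NormedAddCommGroup F] (f : Pt n → F) (p : Pt n) : ℝ≥0∞ :=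
  ENNReal.ofReal (p.1 ^ (-(1 + (n : ℝ)) / 2)) * eLpNorm f 2 (volume.restrict (whitney p))

/-- The `L_∞` Whitney average `W_∞ f(t,x) = ‖f‖_{L_∞(W(t,x))}`, for `t > 0`. -/
def whitneySup {n : ℕ} {F : Type*} [NormedAddCommGroup F] (f : Pt n → F) (p : Pt n) : ℝ≥0∞ :=
  eLpNorm f ⊤ (volume.restrict (whitney p))

/-- The non-tangential maximal function `N g(x) = sup_{|y - x| < s} g(s,y)`. -/
def nonTangMax {n : ℕ} (g : Pt n → ℝ≥0∞) (x : EuclideanSpace ℝ (Fin n)) : ℝ≥0∞ :=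
  ⨆ (p : Pt n) (_ : ‖p.2 - x‖ < p.1), g p

/-- The Carleson functional `C g(x) = sup_{r > 0} r^{-n} ∬_{s > 0, |y - x| < r - s} g(s,y) ds dy`. -/
def carlesonFun {n : ℕ} (g : Pt n → ℝ≥0∞) (x : EuclideanSpace ℝ (Fin n)) : ℝ≥0∞ :=
  ⨆ (r : ℝ) (_ : 0 < r),
    (ENNReal.ofReal (r ^ n))⁻¹ * ∫⁻ p in {p : Pt n | 0 < p.1 ∧ ‖p.2 - x‖ < r - p.1}, g p

/-- The area functional `A g(x) = ∬_{|y - x| < s} g(s,y) s^{-n} ds dy`. -/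
def areaFun {n : ℕ} (g : Pt n → ℝ≥0∞) (x : EuclideanSpace ℝ (Fin n)) : ℝ≥0∞ :=
  ∫⁻ p in {p : Pt n | ‖p.2 - x‖ < p.1}, g p * (ENNReal.ofReal (p.1 ^ n))⁻¹

/-- The norm `‖N(W_2 f)‖_2` of `N_{2,2}`. -/
def normN {n m : ℕ} (f : Pt n → Val n m) : ℝ≥0∞ :=
  eLpNorm (nonTangMax (whitneyTwo f)) 2 volume

/-- The norm `‖C(W_2 f)‖_2` of `C_{2,2}`. -/
def normC {n m : ℕ} (f : Pt n → Val n m) : ℝ≥0∞ :=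
  eLpNorm (carlesonFun (whitneyTwo f)) 2 volume

/-- The second norm `‖A(W_2 f)‖_2` of `C_{2,2}`. -/
def normA {n m : ℕ} (f : Pt n → Val n m) : ℝ≥0∞ :=
  eLpNorm (areaFun (whitneyTwo f)) 2 volume

/-- The norm `(∬ |f(t,x)|² t^α dt dx)^{1/2}` of `L_2(t^α)`. -/
def normL2 {n m : ℕ} (α : ℝ) (f : Pt n → Val n m) : ℝ≥0∞ :=
  (∫⁻ p, ‖f p‖ₑ ^ 2 * ENNReal.ofReal (p.1 ^ α) ∂(halfVol n)) ^ (1 / 2 : ℝ)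

/-- Membership in the function space with norm `ν`: `f` is measurable on the half space
and has finite norm. -/
def MemSpace {n m : ℕ} (ν : (Pt n → Val n m) → ℝ≥0∞) (f : Pt n → Val n m) : Prop :=
  AEStronglyMeasurable f (halfVol n) ∧ ν f < ∞

/-- The multiplication operator `f(t,x) ↦ 𝓔(t,x) f(t,x)`. -/
def mult {n m : ℕ} (E : Pt n → (Val n m →L[ℂ] Val n m)) (f : Pt n → Val n m) : Pt n → Val n m :=
  fun p => E p (f p)

/-- Multiplication by `E` is bounded from the space with norm `ν` to the space with norm `ν'`. -/
def IsBoundedMult {n m : ℕ} (ν ν' : (Pt n → Val n m) → ℝ≥0∞)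
    (E : Pt n → (Val n m →L[ℂ] Val n m)) : Prop :=
  ∃ K : ℝ≥0, ∀ f, MemSpace ν f → MemSpace ν' (mult E f) ∧ ν' (mult E f) ≤ K * ν f

/-- The operator norm `sup_{ν f = 1} ν'(E f)`, an element of `[0,∞]`. -/
def opNorm {n m : ℕ} (ν ν' : (Pt n → Val n m) → ℝ≥0∞)
    (E : Pt n → (Val n m →L[ℂ] Val n m)) : ℝ≥0∞ :=
  ⨆ (f : Pt n → Val n m) (_ : MemSpace ν f ∧ ν f = 1), ν' (mult E f)

/-- The Carleson-Dahlberg norm `‖E‖_* = ‖C(W_∞(|E|²/t))‖_∞^{1/2}`,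
where `|E(t,x)|` is the operator norm. -/
def carlesonDahlberg {n m : ℕ} (E : Pt n → (Val n m →L[ℂ] Val n m)) : ℝ≥0∞ :=
  (eLpNorm (carlesonFun (whitneySup fun p : Pt n => ‖E p‖ ^ 2 / p.1)) ⊤
    (volume : Measure (EuclideanSpace ℝ (Fin n)))) ^ (1 / 2 : ℝ)

/-- `a ≈ b` with constant `K`. -/
def Comparable (K : ℝ≥0) (a b : ℝ≥0∞) : Prop := a ≤ K * b ∧ b ≤ K * a

end CarlesonMult

end

noncomputable section

namespace CarlesonMult

open Set Metric Filter

/-! ### Layer-cake formulas in `[0, ∞]` -/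

/-! Write `G(q)` for the essential supremum of `|E|²/t` over the Whitney region of `q`. Condition
(iii) says that `G` is a Carleson density: its integral over each tent of radius `r` is at most a
multiple of `‖E‖_*² r^n`.

Sufficiency. Averaging over Whitney regions costs only constants, so the integral of `|Ef|²/t` is
controlled by that of `G · (W_2 f)²`. Carleson's embedding (`carleson_embedding`) bounds this by
`‖E‖_*² ‖N(W_2 f)‖_2²`, which is (i) (`normL2_mult_sq_le`). For (ii) with the functional `A`,
dualise against `φ` on `ℝⁿ`: by Tonelli the pairing of `A w` with `φ` is the pairing of `w` with the
ball averages of `φ`. With `w = W_2(Ef) ≤ (G · avg(t|f|²))^{1/2}`, Cauchy-Schwarz leaves the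
integral of `G` times squared ball averages, handled by the embedding and the Hardy-Littlewood
theorem (`normA_mult_sq_le`). The functional `C` is then dominated through `C g ≲ M(A g)`
(`carlesonFun_le_maximal`, `normC_sq_le`). The reverse domination of `A` by `C` is never used: the
bound with `C` gives (iii), and (iii) gives the bound with `A`.

Necessity. Cut the half space into Whitney cells `Q_i`, fix a unit vector `v`, and choose finite
levels `λ_i` such that `|Ev|²/t ≥ λ_i` on a non-null `F_i ⊆ Q_i`. The test function is `a_i v` on
`F_i`, with the mass `a_i²|F_i| = β_i|Q_i|` prescribed, so the smallness of `F_i` does not matter.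
With `β_i = 1` its norm in `N_{2,2}` is at most a multiple of `r^{n/2}`, while its image has squared
norm at least `S = Σ λ_i|Q_i|` (`sum_le_of_bounded_N`). With `β_i = λ_i/2^{k_i}`, where `2^{k_i}` is
the scale of `Q_i`, its squared norm in `L_2(t)` is at most `2S`, while `C(W_2(Ef)) ≳ S r^{-n}` on a
ball of radius `r`; hence `S² r^{-n} ≲ S` up to the squared operator norm (`sum_le_of_bounded_C`).
Either way `S ≲ r^n`. Summing over neighbouring cells and over a basis of vectors `v` recovers the
Carleson bound on `G` (`carlesonDahlberg_sq_le`). -/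

lemma layerCake (a : ℝ≥0∞) :
    ∫⁻ t in Ioi (0 : ℝ), {t : ℝ | ENNReal.ofReal t < a}.indicator 1 t = a := by
  have hm : MeasurableSet {t : ℝ | ENNReal.ofReal t < a} :=
    measurableSet_lt ENNReal.measurable_ofReal measurable_const
  rw [lintegral_indicator_one hm, Measure.restrict_apply hm]
  rcases eq_or_ne a ⊤ with rfl | ha
  · simp
  · have : {t : ℝ | ENNReal.ofReal t < a} ∩ Ioi 0 = Ioo 0 a.toReal := by
      ext t
      simp only [mem_inter_iff, mem_ofPred_eq, mem_Ioi, mem_Ioo]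
      constructor
      · rintro ⟨h1, h2⟩
        exact ⟨h2, (ENNReal.ofReal_lt_iff_lt_toReal h2.le ha).1 h1⟩
      · rintro ⟨h1, h2⟩
        exact ⟨(ENNReal.ofReal_lt_iff_lt_toReal h1.le ha).2 h2, h1⟩
    rw [this, Real.volume_Ioo, sub_zero, ENNReal.ofReal_toReal ha]

lemma sq_layerCake (a : ℝ≥0∞) :
    ∫⁻ t in Ioi (0 : ℝ), {t : ℝ | ENNReal.ofReal t < a}.indicator
      (fun t => 2 * ENNReal.ofReal t) t = a ^ 2 := by
  have hm : MeasurableSet {t : ℝ | ENNReal.ofReal t < a} :=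
    measurableSet_lt ENNReal.measurable_ofReal measurable_const
  rw [lintegral_indicator hm, Measure.restrict_restrict hm]
  rcases eq_or_ne a ⊤ with rfl | ha
  · simp only [ENNReal.ofReal_lt_top, ofPred_true, univ_inter]
    rw [eq_comm, ENNReal.top_pow two_ne_zero, eq_comm, eq_top_iff]
    calc (⊤ : ℝ≥0∞) = ∫⁻ t in Ioi (1 : ℝ), 1 := by simp
      _ ≤ ∫⁻ t in Ioi (1 : ℝ), 2 * ENNReal.ofReal t := by
        refine setLIntegral_mono (by fun_prop) fun t ht => ?_
        have h1 : (1 : ℝ≥0∞) ≤ ENNReal.ofReal t := by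
          rw [← ENNReal.ofReal_one]; exact ENNReal.ofReal_le_ofReal (le_of_lt ht)
        calc (1 : ℝ≥0∞) ≤ 2 * 1 := by norm_num
          _ ≤ _ := by gcongr
      _ ≤ _ := lintegral_mono_set (Ioi_subset_Ioi zero_le_one)
  · have : {t : ℝ | ENNReal.ofReal t < a} ∩ Ioi 0 = Ioo 0 a.toReal := by
      ext t
      simp only [mem_inter_iff, mem_ofPred_eq, mem_Ioi, mem_Ioo]
      constructor
      · rintro ⟨h1, h2⟩
        exact ⟨h2, (ENNReal.ofReal_lt_iff_lt_toReal h2.le ha).1 h1⟩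
      · rintro ⟨h1, h2⟩
        exact ⟨(ENNReal.ofReal_lt_iff_lt_toReal h1.le ha).2 h2, h1⟩
    rw [this, Measure.restrict_congr_set Ioo_ae_eq_Ioc]
    have h2 : ∀ t : ℝ, 2 * ENNReal.ofReal t = ENNReal.ofReal (2 * t) := fun t => by
      rw [ENNReal.ofReal_mul zero_le_two, ENNReal.ofReal_ofNat]
    simp_rw [h2]
    have hint : IntegrableOn (fun t : ℝ => 2 * t) (Ioc 0 a.toReal) :=
      (Continuous.integrableOn_Icc (by fun_prop)).mono_set Ioc_subset_Icc_self
    rw [← ofReal_integral_eq_lintegral_ofReal hint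
      ((ae_restrict_mem measurableSet_Ioc).mono fun t ht => by
        have := ht.1; simp only [Pi.zero_apply]; positivity),
      ← intervalIntegral.integral_of_le ENNReal.toReal_nonneg,
      intervalIntegral.integral_const_mul, integral_id]
    have : 2 * ((a.toReal ^ 2 - 0 ^ 2) / 2) = a.toReal ^ 2 := by ring
    rw [this, ENNReal.ofReal_pow ENNReal.toReal_nonneg, ENNReal.ofReal_toReal ha]

section
variable {α : Type*} [MeasurableSpace α]

lemma measurable_indicator_superlevel {g h : α → ℝ≥0∞} (hg : Measurable g) (hh : Measurable h)
    {k : ℝ → ℝ≥0∞} (hk : Measurable k) :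
    Measurable (Function.uncurry fun (x : α) (t : ℝ) =>
      h x * {t : ℝ | ENNReal.ofReal t < g x}.indicator k t) := by
  have hs : MeasurableSet {z : α × ℝ | ENNReal.ofReal z.2 < g z.1} :=
    measurableSet_lt (by fun_prop) (by fun_prop)
  have : (Function.uncurry fun (x : α) (t : ℝ) =>
      h x * {t : ℝ | ENNReal.ofReal t < g x}.indicator k t) =
      fun z : α × ℝ => h z.1 * {z : α × ℝ | ENNReal.ofReal z.2 < g z.1}.indicator
        (fun z => k z.2) z := by
    ext ⟨x, t⟩
    simp [Function.uncurry, indicator]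
  rw [this]
  exact (hh.comp measurable_fst).mul ((hk.comp measurable_snd).indicator hs)

/-- Layer-cake in `g` with weight `h`. It reduces the embedding to superlevel sets of `g`, and it
reassembles the truncated integrals in the maximal theorem. -/
lemma lintegral_mul_eq_lintegral_superlevel {μ : Measure α} [SFinite μ] {g h : α → ℝ≥0∞}
    (hg : Measurable g) (hh : Measurable h) :
    ∫⁻ x, h x * g x ∂μ =
      ∫⁻ t in Ioi (0 : ℝ), ∫⁻ x in {x | ENNReal.ofReal t < g x}, h x ∂μ := by
  calc ∫⁻ x, h x * g x ∂μ
      = ∫⁻ x, (∫⁻ t in Ioi (0 : ℝ),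
          h x * {t : ℝ | ENNReal.ofReal t < g x}.indicator 1 t) ∂μ := by
        refine lintegral_congr fun x => ?_
        rw [lintegral_const_mul, layerCake]
        exact measurable_one.indicator
          (measurableSet_lt ENNReal.measurable_ofReal measurable_const)
    _ = ∫⁻ t in Ioi (0 : ℝ), ∫⁻ x,
          h x * {t : ℝ | ENNReal.ofReal t < g x}.indicator 1 t ∂μ :=
        lintegral_lintegral_swap
          (measurable_indicator_superlevel hg hh measurable_one).aemeasurable
    _ = _ := by
        refine lintegral_congr fun t => ?_
        rw [← lintegral_indicator (measurableSet_lt measurable_const hg)]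
        refine lintegral_congr fun x => ?_
        simp [indicator]

lemma lintegral_sq_eq_lintegral_superlevel {μ : Measure α} [SFinite μ] {g : α → ℝ≥0∞}
    (hg : Measurable g) :
    ∫⁻ x, g x ^ 2 ∂μ =
      ∫⁻ t in Ioi (0 : ℝ), 2 * ENNReal.ofReal t * μ {x | ENNReal.ofReal t < g x} := by
  calc ∫⁻ x, g x ^ 2 ∂μ
      = ∫⁻ x, (∫⁻ t in Ioi (0 : ℝ), 1 * {t : ℝ | ENNReal.ofReal t < g x}.indicator
          (fun t => 2 * ENNReal.ofReal t) t) ∂μ := by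
        refine lintegral_congr fun x => ?_
        simp_rw [one_mul]
        rw [sq_layerCake]
    _ = ∫⁻ t in Ioi (0 : ℝ), ∫⁻ x, 1 * {t : ℝ | ENNReal.ofReal t < g x}.indicator
          (fun t => 2 * ENNReal.ofReal t) t ∂μ :=
        lintegral_lintegral_swap
          (measurable_indicator_superlevel hg measurable_one (by fun_prop)).aemeasurable
    _ = _ := by
        refine lintegral_congr fun t => ?_
        rw [← lintegral_indicator_const (measurableSet_lt measurable_const hg)]
        refine lintegral_congr fun x => ?_
        simp [indicator]

end

/-! ### Volumes of balls and a Vitali selection -/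

/-- The volume of the unit ball of `ℝⁿ`. -/
def unitVol (n : ℕ) : ℝ≥0∞ := volume (ball (0 : EuclideanSpace ℝ (Fin n)) 1)

lemma unitVol_ne_zero (n : ℕ) : unitVol n ≠ 0 := (measure_ball_pos _ _ one_pos).ne'

lemma unitVol_ne_top (n : ℕ) : unitVol n ≠ ⊤ := measure_ball_lt_top.ne

lemma volume_ball_eq {n : ℕ} (x : EuclideanSpace ℝ (Fin n)) {r : ℝ} (hr : 0 < r) :
    volume (ball x r) = ENNReal.ofReal (r ^ n) * unitVol n := by
  rw [Measure.addHaar_ball_of_pos _ _ hr, finrank_euclideanSpace_fin, unitVol]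

lemma ofReal_pow_ne_zero {r : ℝ} (hr : 0 < r) (n : ℕ) : ENNReal.ofReal (r ^ n) ≠ 0 := by
  have : 0 < r ^ n := by positivity
  simpa using this

/-- Supplies the uniform bound on radii that the Vitali selection requires; a bound on `r ^ n` says
nothing about `r` when `n = 0`. -/
lemma le_of_ofReal_pow_le {n : ℕ} (hn : 1 ≤ n) {A : ℝ≥0∞} (hA : A ≠ ⊤) {r : ℝ}
    (h : ENNReal.ofReal (r ^ n) ≤ A) : r ≤ 1 + A.toReal := by
  by_contra! hlt
  have h1 : 1 ≤ r := by linarith [@ENNReal.toReal_nonneg A]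
  have h2 : r ≤ r ^ n := le_self_pow₀ h1 (by omega)
  have h3 : r ^ n ≤ A.toReal := (ENNReal.ofReal_le_iff_le_toReal hA).1 h
  linarith

/-- A point `(s, y)` is identified with its shadow `B(y, s)`. The selected shadow `q` meets that of
`p` and has at least half its radius, so the centres are less than `p.1 + q.1 ≤ 3 q.1` apart. -/
lemma exists_vitali_subfamily {n : ℕ} (t : Set (Pt n)) (ht : ∀ p ∈ t, 0 < p.1) (R : ℝ)
    (hR : ∀ p ∈ t, p.1 ≤ R) :
    ∃ u ⊆ t, u.Countable ∧ (u.PairwiseDisjoint fun p => ball p.2 p.1) ∧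
      ∀ p ∈ t, ∃ q ∈ u, p.1 ≤ 2 * q.1 ∧ ‖p.2 - q.2‖ < 3 * q.1 := by
  obtain ⟨u, hut, hdisj, hcov⟩ := Vitali.exists_disjoint_subfamily_covering_enlargement
    (fun p : Pt n => ball p.2 p.1) t (fun p => p.1) 2 one_lt_two (fun p hp => (ht p hp).le) R hR
    (fun p hp => nonempty_ball.2 (ht p hp))
  refine ⟨u, hut, hdisj.countable_of_isOpen (fun _ _ => isOpen_ball)
    (fun p hp => nonempty_ball.2 (ht p (hut hp))), hdisj, fun p hp => ?_⟩
  obtain ⟨q, hq, ⟨z, hz1, hz2⟩, hle⟩ := hcov p hp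
  refine ⟨q, hq, hle, ?_⟩
  rw [mem_ball] at hz1 hz2
  rw [← dist_eq_norm]
  have := dist_triangle_left p.2 q.2 z
  linarith

/-! ### The non-tangential maximal function -/

/-- Superlevel sets are unions of shadows, hence open, so the maximal function is measurable for
arbitrary `g`. -/
lemma nonTangMax_superlevel {n : ℕ} (g : Pt n → ℝ≥0∞) (a : ℝ≥0∞) :
    {x | a < nonTangMax g x} = ⋃ p ∈ {p : Pt n | a < g p}, ball p.2 p.1 := by
  ext x
  simp only [nonTangMax, mem_ofPred_eq, lt_iSup_iff, mem_iUnion, mem_ball, exists_prop]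
  refine exists_congr fun p => ?_
  rw [dist_comm, dist_eq_norm, and_comm]

lemma measurable_nonTangMax {n : ℕ} (g : Pt n → ℝ≥0∞) : Measurable (nonTangMax g) := by
  refine measurable_of_Ioi fun a => IsOpen.measurableSet ?_
  have := nonTangMax_superlevel g a
  change IsOpen {x | a < nonTangMax g x}
  rw [this]
  exact isOpen_biUnion fun _ _ => isOpen_ball

lemma le_nonTangMax {n : ℕ} (g : Pt n → ℝ≥0∞) {p : Pt n} {x : EuclideanSpace ℝ (Fin n)}
    (h : ‖p.2 - x‖ < p.1) : g p ≤ nonTangMax g x :=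
  le_iSup₂ (f := fun (p : Pt n) (_ : ‖p.2 - x‖ < p.1) => g p) p h

lemma nonTangMax_sq_le {n : ℕ} (g : Pt n → ℝ≥0∞) (x : EuclideanSpace ℝ (Fin n)) :
    nonTangMax (fun p => g p ^ 2) x ≤ nonTangMax g x ^ 2 :=
  iSup₂_le fun _ hp => pow_le_pow_left' (le_nonTangMax g hp) 2

/-! ### The Hardy-Littlewood maximal theorem in `L₂` -/

/-- The average `s^{-n} ∫_{B(y,s)} φ`, up to the volume of the unit ball. -/
def ballAvg {n : ℕ} (φ : EuclideanSpace ℝ (Fin n) → ℝ≥0∞) (p : Pt n) : ℝ≥0∞ :=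
  (ENNReal.ofReal (p.1 ^ n))⁻¹ * ∫⁻ z in ball p.2 p.1, φ z

lemma pos_of_lt_ballAvg {n : ℕ} {φ : EuclideanSpace ℝ (Fin n) → ℝ≥0∞} {p : Pt n} {a : ℝ≥0∞}
    (h : a < ballAvg φ p) : 0 < p.1 := by
  by_contra! hp
  simp [ballAvg, ball_eq_empty.2 hp] at h

/-- `nonTangMax (ballAvg φ)` is the non-centred Hardy-Littlewood maximal function, up to the volume
of the unit ball. The enlargement factor `5` is `2 + 3` from the Vitali selection. -/
lemma weak_type_maximal {n : ℕ} (hn : 1 ≤ n) (φ : EuclideanSpace ℝ (Fin n) → ℝ≥0∞)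
    {a : ℝ≥0∞} (ha : a ≠ 0) (ha' : a ≠ ⊤) :
    volume {x | a < nonTangMax (ballAvg φ) x} ≤
      ENNReal.ofReal (5 ^ n) * unitVol n * (a⁻¹ * ∫⁻ z, φ z) := by
  rcases eq_or_ne (∫⁻ z, φ z) ⊤ with htop | htop
  · rw [htop, ENNReal.mul_top (ENNReal.inv_ne_zero.2 ha'), ENNReal.mul_top]
    · exact le_top
    · exact mul_ne_zero (ofReal_pow_ne_zero (by norm_num) n) (unitVol_ne_zero n)
  set t : Set (Pt n) := {p | a < ballAvg φ p}
  have htpos : ∀ p ∈ t, 0 < p.1 := fun p hp => pos_of_lt_ballAvg hp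
  have hkey : ∀ p ∈ t, ENNReal.ofReal (p.1 ^ n) ≤ a⁻¹ * ∫⁻ z in ball p.2 p.1, φ z := by
    intro p hp
    have h0 := ofReal_pow_ne_zero (htpos p hp) n
    have h1 : a ≤ (ENNReal.ofReal (p.1 ^ n))⁻¹ * ∫⁻ z in ball p.2 p.1, φ z := le_of_lt hp
    rw [mul_comm, ← div_eq_mul_inv, ENNReal.le_div_iff_mul_le (Or.inl h0)
      (Or.inl ENNReal.ofReal_ne_top)] at h1
    rw [mul_comm, ← div_eq_mul_inv, ENNReal.le_div_iff_mul_le (Or.inl ha) (Or.inl ha'), mul_comm]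
    exact h1
  have hfin : a⁻¹ * ∫⁻ z, φ z ≠ ⊤ := ENNReal.mul_ne_top (ENNReal.inv_ne_top.2 ha) htop
  obtain ⟨u, hut, hcount, hdisj, hcov⟩ := exists_vitali_subfamily t htpos
    (1 + (a⁻¹ * ∫⁻ z, φ z).toReal) fun p hp => le_of_ofReal_pow_le hn hfin
      ((hkey p hp).trans (by gcongr; exact Measure.restrict_le_self))
  have hsub : {x | a < nonTangMax (ballAvg φ) x} ⊆ ⋃ q ∈ u, ball q.2 (5 * q.1) := by
    rw [nonTangMax_superlevel]
    intro x hx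
    simp only [mem_iUnion, exists_prop] at hx ⊢
    obtain ⟨p, hp, hxp⟩ := hx
    obtain ⟨q, hq, h1, h2⟩ := hcov p hp
    refine ⟨q, hq, ?_⟩
    rw [mem_ball] at hxp ⊢
    rw [← dist_eq_norm] at h2
    linarith [dist_triangle x p.2 q.2]
  calc volume {x | a < nonTangMax (ballAvg φ) x}
      ≤ volume (⋃ q ∈ u, ball q.2 (5 * q.1)) := measure_mono hsub
    _ ≤ ∑' q : u, volume (ball (q : Pt n).2 (5 * (q : Pt n).1)) :=
        measure_biUnion_le _ hcount _
    _ ≤ ∑' q : u, ENNReal.ofReal (5 ^ n) * unitVol n *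
          (a⁻¹ * ∫⁻ z in ball (q : Pt n).2 (q : Pt n).1, φ z) := by
        refine ENNReal.tsum_le_tsum fun q => ?_
        have hq := htpos _ (hut q.2)
        rw [volume_ball_eq _ (by positivity), mul_pow, ENNReal.ofReal_mul (by positivity),
          mul_right_comm]
        gcongr
        exact hkey _ (hut q.2)
    _ = ENNReal.ofReal (5 ^ n) * unitVol n *
          (a⁻¹ * ∫⁻ z in ⋃ q ∈ u, ball q.2 q.1, φ z) := by
        rw [lintegral_biUnion hcount (fun _ _ => measurableSet_ball) hdisj, ENNReal.tsum_mul_left,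
          ENNReal.tsum_mul_left]
    _ ≤ _ := by gcongr; exact Measure.restrict_le_self

/-- The part of `φ` not exceeding `b` contributes at most `b` times the unit volume to each average,
so only the large part matters at high levels. -/
lemma ballAvg_le_add {n : ℕ} (φ : EuclideanSpace ℝ (Fin n) → ℝ≥0∞)
    (p : Pt n) (b : ℝ≥0∞) :
    ballAvg φ p ≤ ballAvg ({z | b < φ z}.indicator φ) p + b * unitVol n := by
  rcases le_or_gt p.1 0 with hp | hp
  · simp [ballAvg, ball_eq_empty.2 hp]
  have hle : ∀ z, φ z ≤ {z | b < φ z}.indicator φ z + b := by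
    intro z
    by_cases hz : b < φ z
    · rw [indicator_of_mem (show z ∈ {z | b < φ z} from hz)]; exact le_self_add
    · exact (not_lt.1 hz).trans le_add_self
  unfold ballAvg
  calc _ ≤ (ENNReal.ofReal (p.1 ^ n))⁻¹ *
        ∫⁻ z in ball p.2 p.1, ({z | b < φ z}.indicator φ z + b) := by gcongr; exact hle _
    _ = _ := by
      rw [lintegral_add_right _ measurable_const, mul_add, setLIntegral_const,
        volume_ball_eq _ hp]
      congr 1
      rw [mul_left_comm b, ← mul_assoc, ENNReal.inv_mul_cancel (ofReal_pow_ne_zero hp n)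
        ENNReal.ofReal_ne_top, one_mul]

/-- The constant of the maximal theorem. -/
def maxConst (n : ℕ) : ℝ≥0∞ := 8 * ENNReal.ofReal (5 ^ n) * unitVol n ^ 2

lemma maxConst_ne_top (n : ℕ) : maxConst n ≠ ⊤ :=
  ENNReal.mul_ne_top (ENNReal.mul_ne_top (by simp) ENNReal.ofReal_ne_top)
    (ENNReal.pow_ne_top (unitVol_ne_top n))

theorem lintegral_sq_maximal_le {n : ℕ} (hn : 1 ≤ n) (φ : EuclideanSpace ℝ (Fin n) → ℝ≥0∞)
    (hφ : Measurable φ) :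
    ∫⁻ x, nonTangMax (ballAvg φ) x ^ 2 ≤ maxConst n * ∫⁻ x, φ x ^ 2 := by
  set ω := unitVol n
  have hω := unitVol_ne_zero n
  have hω' := unitVol_ne_top n
  set c := ENNReal.ofReal (5 ^ n)
  have hlevel : ∀ t ∈ Ioi (0 : ℝ),
      2 * ENNReal.ofReal t * volume {x | ENNReal.ofReal t < nonTangMax (ballAvg φ) x} ≤
        4 * c * ω * ∫⁻ z in {z | ENNReal.ofReal t < 2 * ω * φ z}, φ z := by
    intro t ht
    set a := ENNReal.ofReal t with ha_def
    have ha : a ≠ 0 := by simpa [ha_def] using ht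
    have ha' : a ≠ ⊤ := ENNReal.ofReal_ne_top
    -- With this truncation height the small part of `φ` accounts for at most half of the level `a`,
    -- and the weak-type bound is applied to the rest at level `a / 2`.
    set b := a / 2 / ω
    have hb : b * ω = a / 2 := ENNReal.div_mul_cancel hω hω'
    have hsub : {x | a < nonTangMax (ballAvg φ) x} ⊆
        {x | a / 2 < nonTangMax (ballAvg ({z | b < φ z}.indicator φ)) x} := by
      rw [nonTangMax_superlevel, nonTangMax_superlevel]
      refine biUnion_subset_biUnion_left fun p hp => ?_
      have h1 : a < ballAvg ({z | b < φ z}.indicator φ) p + a / 2 := by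
        rw [← hb]; exact lt_of_lt_of_le hp (ballAvg_le_add φ p b)
      by_contra hcon
      rw [mem_ofPred_eq, not_lt] at hcon
      have : ballAvg ({z | b < φ z}.indicator φ) p + a / 2 ≤ a / 2 + a / 2 := by gcongr
      rw [ENNReal.add_halves] at this
      exact absurd (h1.trans_le this) (lt_irrefl _)
    have hset : {z | b < φ z} = {z | a < 2 * ω * φ z} := by
      ext z
      simp only [mem_ofPred_eq, b]
      rw [ENNReal.div_lt_iff (Or.inl hω) (Or.inl hω'), ENNReal.div_lt_iff (Or.inl (by simp))
        (Or.inl (by simp))]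
      rw [show φ z * ω * 2 = 2 * ω * φ z by ring]
    have hm : MeasurableSet {z | a < 2 * ω * φ z} :=
      measurableSet_lt measurable_const (by fun_prop)
    calc 2 * a * volume {x | a < nonTangMax (ballAvg φ) x}
        ≤ 2 * a * (c * ω * ((a / 2)⁻¹ * ∫⁻ z, {z | b < φ z}.indicator φ z)) := by
          gcongr
          exact (measure_mono hsub).trans (weak_type_maximal hn _
            (ENNReal.div_pos ha (by simp)).ne' (ENNReal.div_ne_top ha' (by simp)))
      _ = 4 * c * ω * ∫⁻ z in {z | a < 2 * ω * φ z}, φ z := by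
          rw [hset, lintegral_indicator hm, ENNReal.inv_div (by simp) (by simp), div_eq_mul_inv]
          rw [show ∀ I : ℝ≥0∞, 2 * a * (c * ω * (2 * a⁻¹ * I)) = (a * a⁻¹) * (4 * c * ω * I) by
            intro I; ring, ENNReal.mul_inv_cancel ha ha', one_mul]
  calc ∫⁻ x, nonTangMax (ballAvg φ) x ^ 2
      = ∫⁻ t in Ioi (0 : ℝ),
          2 * ENNReal.ofReal t * volume {x | ENNReal.ofReal t < nonTangMax (ballAvg φ) x} :=
        lintegral_sq_eq_lintegral_superlevel (measurable_nonTangMax _)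
    _ ≤ ∫⁻ t in Ioi (0 : ℝ),
          4 * c * ω * ∫⁻ z in {z | ENNReal.ofReal t < 2 * ω * φ z}, φ z :=
        setLIntegral_mono' measurableSet_Ioi hlevel
    _ = 4 * c * ω * ∫⁻ z, φ z * (2 * ω * φ z) := by
        rw [lintegral_const_mul' _ _ (ENNReal.mul_ne_top (ENNReal.mul_ne_top (by simp)
          ENNReal.ofReal_ne_top) hω'), lintegral_mul_eq_lintegral_superlevel (by fun_prop) hφ]
    _ = _ := by
        have : ∀ z, φ z * (2 * ω * φ z) = 2 * ω * φ z ^ 2 := fun z => by ring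
        simp_rw [this]
        rw [lintegral_const_mul' _ _ (ENNReal.mul_ne_top (by simp) hω'), maxConst]
        ring

/-! ### Carleson's embedding -/

/-- The tent `{(s, y) : s > 0, |y - x| < r - s}`. -/
def tent {n : ℕ} (x : EuclideanSpace ℝ (Fin n)) (r : ℝ) : Set (Pt n) :=
  {p | 0 < p.1 ∧ ‖p.2 - x‖ < r - p.1}

lemma measurableSet_tent {n : ℕ} (x : EuclideanSpace ℝ (Fin n)) (r : ℝ) :
    MeasurableSet (tent x r) :=
  (measurableSet_lt measurable_const measurable_fst).inter
    (measurableSet_lt (f := fun p : Pt n => ‖p.2 - x‖) (g := fun p : Pt n => r - p.1)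
      (by fun_prop) (by fun_prop))

lemma measurableSet_halfSpace (n : ℕ) : MeasurableSet (halfSpace n) :=
  measurableSet_lt measurable_const measurable_fst

lemma halfSpace_subset_iUnion_tent (n : ℕ) :
    halfSpace n ⊆ ⋃ k : ℕ, tent (0 : EuclideanSpace ℝ (Fin n)) k := by
  intro p hp
  obtain ⟨k, hk⟩ := exists_nat_gt (‖p.2‖ + p.1)
  exact mem_iUnion.2 ⟨k, hp, by rw [sub_zero]; linarith⟩

/-- Every point with `g > a` has its shadow inside `{N g > a}`. Disjoint shadows are selected whose
sixfold tents cover these points (`2 + 3 ≤ 6`); the Carleson condition bounds each tent by the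
volume of its shadow, and the disjoint volumes add up inside `{N g > a}`. -/
lemma lintegral_superlevel_le {n : ℕ} (hn : 1 ≤ n) {G g : Pt n → ℝ≥0∞} {K : ℝ≥0∞} (hK : K ≠ 0)
    (hG : ∀ x r, 0 < r → ∫⁻ p in tent x r, G p ≤ K * ENNReal.ofReal (r ^ n)) (a : ℝ≥0∞) :
    ∫⁻ p in {p | a < g p} ∩ halfSpace n, G p ≤
      K * (ENNReal.ofReal (6 ^ n) * (unitVol n)⁻¹) * volume {x | a < nonTangMax g x} := by
  set O := {x | a < nonTangMax g x}
  have hω := unitVol_ne_zero n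
  have hω' := unitVol_ne_top n
  rcases eq_or_ne (volume O) ⊤ with htop | htop
  · rw [htop, ENNReal.mul_top]
    · exact le_top
    · exact mul_ne_zero hK (mul_ne_zero (ofReal_pow_ne_zero (by norm_num) n)
        (ENNReal.inv_ne_zero.2 hω'))
  set t : Set (Pt n) := {p | a < g p} ∩ halfSpace n
  have hball : ∀ p ∈ t, ball p.2 p.1 ⊆ O := by
    intro p hp x hx
    refine lt_of_lt_of_le hp.1 (le_nonTangMax g ?_)
    rwa [mem_ball, dist_comm, dist_eq_norm] at hx
  have hpow : ∀ p : Pt n, 0 < p.1 →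
      ENNReal.ofReal (p.1 ^ n) = (unitVol n)⁻¹ * volume (ball p.2 p.1) := by
    intro p hp
    rw [volume_ball_eq _ hp, mul_left_comm, ENNReal.inv_mul_cancel hω hω', mul_one]
  obtain ⟨u, hut, hcount, hdisj, hcov⟩ := exists_vitali_subfamily t (fun p hp => hp.2)
    (1 + ((unitVol n)⁻¹ * volume O).toReal) fun p hp =>
      le_of_ofReal_pow_le hn (ENNReal.mul_ne_top (ENNReal.inv_ne_top.2 hω) htop) (by
        rw [hpow p hp.2]; gcongr; exact hball p hp)
  have hsub : t ⊆ ⋃ q ∈ u, tent q.2 (6 * q.1) := by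
    intro p hp
    obtain ⟨q, hq, h1, h2⟩ := hcov p hp
    have hq0 : 0 < q.1 := (hut hq).2
    exact mem_biUnion hq ⟨hp.2, by linarith⟩
  calc ∫⁻ p in t, G p ≤ ∫⁻ p in ⋃ q ∈ u, tent q.2 (6 * q.1), G p := lintegral_mono_set hsub
    _ ≤ ∑' q : u, ∫⁻ p in tent (q : Pt n).2 (6 * (q : Pt n).1), G p := by
        have := hcount.to_subtype
        rw [biUnion_eq_iUnion]
        exact lintegral_iUnion_le _ _
    _ ≤ ∑' q : u, K * (ENNReal.ofReal (6 ^ n) * (unitVol n)⁻¹) *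
          volume (ball (q : Pt n).2 (q : Pt n).1) := by
        refine ENNReal.tsum_le_tsum fun q => ?_
        have hq : 0 < (q : Pt n).1 := (hut q.2).2
        refine (hG _ _ (by positivity)).trans (le_of_eq ?_)
        rw [mul_pow, ENNReal.ofReal_mul (by positivity), hpow _ hq]
        ring
    _ = K * (ENNReal.ofReal (6 ^ n) * (unitVol n)⁻¹) * volume (⋃ q ∈ u, ball q.2 q.1) := by
        rw [measure_biUnion hcount hdisj (fun _ _ => measurableSet_ball), ENNReal.tsum_mul_left]
    _ ≤ _ := by
        gcongr
        exact iUnion₂_subset fun q hq => hball q (hut hq)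

/-- The constant of Carleson's embedding. -/
def embConst (n : ℕ) : ℝ≥0∞ := ENNReal.ofReal (6 ^ n) * (unitVol n)⁻¹

lemma embConst_ne_top (n : ℕ) : embConst n ≠ ⊤ :=
  ENNReal.mul_ne_top ENNReal.ofReal_ne_top (ENNReal.inv_ne_top.2 (unitVol_ne_zero n))

theorem carleson_embedding {n : ℕ} (hn : 1 ≤ n) {G g : Pt n → ℝ≥0∞} (hGm : Measurable G)
    (hgm : Measurable g) {K : ℝ≥0∞} (hK' : K ≠ ⊤)
    (hG : ∀ x r, 0 < r → ∫⁻ p in tent x r, G p ≤ K * ENNReal.ofReal (r ^ n)) :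
    ∫⁻ p, G p * g p ∂(halfVol n) ≤ K * embConst n * ∫⁻ x, nonTangMax g x := by
  -- For `K = 0` the right side is zero even if the maximal function has infinite integral, so `G`
  -- must be shown to vanish almost everywhere; the half space is a countable union of tents.
  rcases eq_or_ne K 0 with rfl | hK
  · have h0 : ∫⁻ p, G p ∂(halfVol n) = 0 := by
      refine le_antisymm ?_ bot_le
      calc ∫⁻ p in halfSpace n, G p ≤ ∫⁻ p in ⋃ k : ℕ, tent 0 (k : ℝ), G p :=
            lintegral_mono_set (halfSpace_subset_iUnion_tent n)
        _ ≤ ∑' k : ℕ, ∫⁻ p in tent 0 (k : ℝ), G p := lintegral_iUnion_le _ _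
        _ = 0 := by
          rw [ENNReal.tsum_eq_zero]
          intro k
          rcases Nat.eq_zero_or_pos k with rfl | hk
          · have : tent (0 : EuclideanSpace ℝ (Fin n)) ((0 : ℕ) : ℝ) = ∅ := by
              ext p
              simp only [tent, mem_ofPred_eq, mem_empty_iff_false, iff_false, not_and]
              intro h1 h2
              rw [Nat.cast_zero] at h2
              linarith [norm_nonneg (p.2 - 0)]
            rw [this]; simp
          · have := hG 0 k (by exact_mod_cast hk)
            rw [zero_mul] at this
            exact le_antisymm this bot_le
    rw [lintegral_eq_zero_iff hGm] at h0
    have : ∫⁻ p, G p * g p ∂(halfVol n) = 0 := by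
      rw [lintegral_eq_zero_iff (by fun_prop)]
      filter_upwards [h0] with p hp
      simp only [Pi.zero_apply] at hp
      simp [hp]
    rw [this]; exact bot_le
  · have : SFinite (halfVol n) := by unfold halfVol; infer_instance
    rw [lintegral_mul_eq_lintegral_superlevel hgm hGm]
    have h1 : ∫⁻ x, nonTangMax g x = ∫⁻ t in Ioi (0 : ℝ),
        volume {x | ENNReal.ofReal t < nonTangMax g x} := by
      have := lintegral_mul_eq_lintegral_superlevel
        (μ := (volume : Measure (EuclideanSpace ℝ (Fin n)))) (measurable_nonTangMax g)
        (measurable_const (a := (1 : ℝ≥0∞)))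
      simpa using this
    rw [h1, ← lintegral_const_mul' _ _ (ENNReal.mul_ne_top hK' (embConst_ne_top n))]
    refine lintegral_mono fun t => ?_
    rw [halfVol, Measure.restrict_restrict (measurableSet_lt measurable_const hgm)]
    exact lintegral_superlevel_le hn hK hG _

/-! ### Squares of `L₂` norms -/

lemma eLpNorm_two_sq {α ε : Type*} [MeasurableSpace α] [ENorm ε] (f : α → ε) (μ : Measure α) :
    eLpNorm f 2 μ ^ 2 = ∫⁻ x, ‖f x‖ₑ ^ 2 ∂μ := by
  rw [eLpNorm_eq_lintegral_rpow_enorm_toReal two_ne_zero (by simp)]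
  simp only [ENNReal.toReal_ofNat, ENNReal.rpow_ofNat]
  rw [← ENNReal.rpow_two, ← ENNReal.rpow_mul]
  norm_num

lemma rpow_half_sq (a : ℝ≥0∞) : (a ^ (1 / 2 : ℝ)) ^ 2 = a := by
  rw [← ENNReal.rpow_two, ← ENNReal.rpow_mul]
  norm_num

lemma lintegral_mul_sq_le {α : Type*} [MeasurableSpace α] {μ : Measure α} {f g : α → ℝ≥0∞}
    (hf : AEMeasurable f μ) (hg : AEMeasurable g μ) :
    (∫⁻ x, f x * g x ∂μ) ^ 2 ≤ (∫⁻ x, f x ^ 2 ∂μ) * ∫⁻ x, g x ^ 2 ∂μ := by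
  have := ENNReal.lintegral_mul_le_Lp_mul_Lq μ Real.HolderConjugate.two_two hf hg
  simp only [Pi.mul_apply, ENNReal.rpow_two] at this
  calc _ ≤ _ := pow_le_pow_left' this 2
    _ = _ := by rw [mul_pow, rpow_half_sq, rpow_half_sq]

/-- Testing on `φ = f` would suffice if `f` were square integrable. Instead `f` is truncated in
height and support, which makes the integral of `φ²` finite and cancellable, and monotone
convergence removes the truncation. -/
lemma lintegral_sq_le_of_dual {α : Type*} [MeasurableSpace α] {μ : Measure α} [SigmaFinite μ]
    {f : α → ℝ≥0∞} (hf : Measurable f) {D : ℝ≥0∞}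
    (h : ∀ φ : α → ℝ≥0∞, Measurable φ → (∫⁻ x, f x * φ x ∂μ) ^ 2 ≤ D * ∫⁻ x, φ x ^ 2 ∂μ) :
    ∫⁻ x, f x ^ 2 ∂μ ≤ D := by
  set φ : ℕ → α → ℝ≥0∞ := fun k => (spanningSets μ k).indicator fun x => min (f x) k with hφ_def
  have hφm : ∀ k, Measurable (φ k) := fun k =>
    (hf.min measurable_const).indicator (measurableSet_spanningSets μ k)
  have hφle : ∀ k x, φ k x ≤ f x := fun k x =>
    indicator_apply_le' (fun _ => min_le_left _ _) (fun _ => bot_le)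
  have hmono : Monotone φ := by
    intro k l hkl x
    refine indicator_apply_le' (fun hx => ?_) (fun _ => bot_le)
    simp only [hφ_def]
    rw [indicator_of_mem (monotone_spanningSets μ hkl hx)]
    exact min_le_min_left _ (by exact_mod_cast hkl)
  have hsup : ∀ x, ⨆ k, φ k x ^ 2 = f x ^ 2 := by
    intro x
    refine le_antisymm (iSup_le fun k => pow_le_pow_left' (hφle k x) 2) ?_
    have htends : Tendsto (fun k => φ k x ^ 2) atTop (nhds (f x ^ 2)) := by
      refine ((ENNReal.continuous_pow 2).tendsto _).comp ?_
      have h1 : Tendsto (fun k : ℕ => min (f x) (k : ℝ≥0∞)) atTop (nhds (min (f x) ⊤)) :=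
        tendsto_const_nhds.min ENNReal.tendsto_nat_nhds_top
      rw [min_top_right] at h1
      refine h1.congr' ?_
      filter_upwards [eventually_ge_atTop (spanningSetsIndex μ x)] with k hk
      simp only [hφ_def]
      rw [indicator_of_mem (mem_spanningSets_of_index_le μ x hk)]
    exact le_of_tendsto' htends fun k => le_iSup (fun k => φ k x ^ 2) k
  have hbound : ∀ k, ∫⁻ x, φ k x ^ 2 ∂μ ≤ D := by
    intro k
    set I := ∫⁻ x, φ k x ^ 2 ∂μ with hI
    have hfin : I ≠ ⊤ := by
      have : I ≤ ∫⁻ x in spanningSets μ k, (k : ℝ≥0∞) ^ 2 ∂μ := by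
        rw [← lintegral_indicator (measurableSet_spanningSets μ k)]
        refine lintegral_mono fun x => ?_
        by_cases hx : x ∈ spanningSets μ k
        · simp only [hφ_def, indicator_of_mem hx]
          exact pow_le_pow_left' (min_le_right _ _) 2
        · simp [hφ_def, indicator_of_notMem hx]
      refine (this.trans_lt ?_).ne
      rw [setLIntegral_const]
      exact ENNReal.mul_lt_top (by simp) (measure_spanningSets_lt_top μ k)
    rcases eq_or_ne I 0 with h0 | h0
    · rw [h0]; exact bot_le
    have h1 : I ≤ ∫⁻ x, f x * φ k x ∂μ := lintegral_mono fun x => by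
      rw [sq]; gcongr; exact hφle k x
    have h2 : I * I ≤ D * I := by
      rw [← sq]; exact (pow_le_pow_left' h1 2).trans (h _ (hφm k))
    exact (ENNReal.mul_le_mul_iff_left h0 hfin).1 h2
  simp_rw [← hsup]
  rw [lintegral_iSup (fun k => (hφm k).pow_const 2)
    fun k l hkl x => pow_le_pow_left' (hmono hkl x) 2]
  exact iSup_le hbound

/-! ### Whitney regions -/

lemma mem_whitney_iff {n : ℕ} {p q : Pt n} :
    p ∈ whitney q ↔ q.1 / 2 < p.1 ∧ p.1 < 2 * q.1 ∧ ‖p.2 - q.2‖ < q.1 := by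
  simp only [whitney, mem_ofPred_eq]
  rcases le_or_gt q.1 0 with hq | hq
  · have h3 : ¬ ‖p.2 - q.2‖ < q.1 := not_lt.2 (hq.trans (norm_nonneg _))
    simp [h3]
  · rw [lt_div_iff₀ hq, div_lt_iff₀ hq, one_div, inv_mul_eq_div]

lemma pos_of_mem_whitney {n : ℕ} {p q : Pt n} (h : p ∈ whitney q) : 0 < q.1 :=
  (norm_nonneg _).trans_lt (mem_whitney_iff.1 h).2.2

lemma pos_of_mem_whitney' {n : ℕ} {p q : Pt n} (h : p ∈ whitney q) : 0 < p.1 := by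
  have h1 := pos_of_mem_whitney h
  linarith [(mem_whitney_iff.1 h).1]

lemma whitney_subset_halfSpace {n : ℕ} (q : Pt n) : whitney q ⊆ halfSpace n :=
  fun _ hp => pos_of_mem_whitney' hp

lemma whitney_eq_empty {n : ℕ} {q : Pt n} (hq : q.1 ≤ 0) : whitney q = ∅ :=
  eq_empty_of_forall_notMem fun _ hp => (pos_of_mem_whitney hp).not_ge hq

lemma measurableSet_whitneyRel (n : ℕ) :
    MeasurableSet {z : Pt n × Pt n | z.2 ∈ whitney z.1} := by
  simp_rw [mem_whitney_iff]
  have h1 : MeasurableSet {z : Pt n × Pt n | z.1.1 / 2 < z.2.1} :=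
    measurableSet_lt (by fun_prop) (by fun_prop)
  have h2 : MeasurableSet {z : Pt n × Pt n | z.2.1 < 2 * z.1.1} :=
    measurableSet_lt (by fun_prop) (by fun_prop)
  have h3 : MeasurableSet {z : Pt n × Pt n | ‖z.2.2 - z.1.2‖ < z.1.1} :=
    measurableSet_lt (by fun_prop) (by fun_prop)
  exact h1.inter (h2.inter h3)

lemma measurableSet_whitney {n : ℕ} (q : Pt n) : MeasurableSet (whitney q) :=
  measurable_prodMk_left (measurableSet_whitneyRel n)

lemma restrict_whitney_le {n : ℕ} (q : Pt n) : volume.restrict (whitney q) ≤ halfVol n :=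
  Measure.restrict_mono (whitney_subset_halfSpace q) le_rfl

lemma ae_whitney_of_ae {n : ℕ} {P : Pt n → Prop} (h : ∀ᵐ p ∂(halfVol n), P p) (q : Pt n) :
    ∀ᵐ p ∂(volume.restrict (whitney q)), P p :=
  Measure.absolutelyContinuous_of_le (restrict_whitney_le q) h

lemma whitneyTwo_congr {n : ℕ} {F : Type*} [NormedAddCommGroup F] {f g : Pt n → F}
    (h : f =ᵐ[halfVol n] g) : whitneyTwo f = whitneyTwo g := by
  funext q
  rw [whitneyTwo, whitneyTwo, eLpNorm_congr_ae (ae_whitney_of_ae h q)]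

lemma whitneySup_congr {n : ℕ} {F : Type*} [NormedAddCommGroup F] {f g : Pt n → F}
    (h : f =ᵐ[halfVol n] g) : whitneySup f = whitneySup g := by
  funext q
  rw [whitneySup, whitneySup, eLpNorm_congr_ae (ae_whitney_of_ae h q)]

/-- The Whitney average `t^{-(1+n)} ∫_{W(t,x)} Φ`. -/
def whitneyAvg {n : ℕ} (Φ : Pt n → ℝ≥0∞) (q : Pt n) : ℝ≥0∞ :=
  (ENNReal.ofReal (q.1 ^ (n + 1)))⁻¹ * ∫⁻ p in whitney q, Φ p

lemma whitneyAvg_of_nonpos {n : ℕ} (Φ : Pt n → ℝ≥0∞) {q : Pt n} (hq : q.1 ≤ 0) :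
    whitneyAvg Φ q = 0 := by
  simp [whitneyAvg, whitney_eq_empty hq]

lemma whitneyTwo_sq {n : ℕ} {F : Type*} [NormedAddCommGroup F] (f : Pt n → F) (q : Pt n) :
    whitneyTwo f q ^ 2 = whitneyAvg (fun p => ‖f p‖ₑ ^ 2) q := by
  rcases le_or_gt q.1 0 with hq | hq
  · simp [whitneyTwo, whitneyAvg_of_nonpos _ hq, whitney_eq_empty hq]
  · rw [whitneyTwo, mul_pow, eLpNorm_two_sq, whitneyAvg, ← ENNReal.ofReal_pow (by positivity),
      ← ENNReal.ofReal_inv_of_pos (by positivity), ← Real.rpow_natCast (q.1 ^ _),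
      ← Real.rpow_mul hq.le, ← Real.rpow_natCast q.1, ← Real.rpow_neg hq.le]
    congr 3
    push_cast
    ring_nf

lemma measurable_whitneyAvg {n : ℕ} {Φ : Pt n → ℝ≥0∞} (hΦ : Measurable Φ) :
    Measurable (whitneyAvg Φ) := by
  have h1 : Measurable fun q : Pt n => ∫⁻ p,
      {z : Pt n × Pt n | z.2 ∈ whitney z.1}.indicator (fun z => Φ z.2) (q, p) :=
    Measurable.lintegral_prod_right' ((hΦ.comp measurable_snd).indicator
      (measurableSet_whitneyRel n))
  have h2 : ∀ q : Pt n, ∫⁻ p in whitney q, Φ p = ∫⁻ p,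
      {z : Pt n × Pt n | z.2 ∈ whitney z.1}.indicator (fun z => Φ z.2) (q, p) := by
    intro q
    rw [← lintegral_indicator (measurableSet_whitney q)]
    rfl
  unfold whitneyAvg
  simp_rw [h2]
  exact Measurable.mul (by fun_prop) h1

lemma measurable_whitneyTwo {n : ℕ} {F : Type*} [NormedAddCommGroup F] {f : Pt n → F}
    (hf : Measurable fun p => ‖f p‖ₑ) : Measurable (whitneyTwo f) := by
  have h : whitneyTwo f = fun q => (whitneyAvg (fun p => ‖f p‖ₑ ^ 2) q) ^ (1 / 2 : ℝ) := by
    funext q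
    rw [← whitneyTwo_sq, ← ENNReal.rpow_two, ← ENNReal.rpow_mul]
    norm_num
  rw [h]
  exact (measurable_whitneyAvg (hf.pow_const 2)).pow_const _

lemma lt_essSup_iff {α : Type*} [MeasurableSpace α] {μ : Measure α} {f : α → ℝ≥0∞} {a : ℝ≥0∞} :
    a < essSup f μ ↔ μ {x | a < f x} ≠ 0 := by
  rw [← not_iff_not, not_lt, not_not]
  constructor
  · intro h
    have : ∀ᵐ x ∂μ, f x ≤ a := (ENNReal.ae_le_essSup f).mono fun x hx => hx.trans h
    simpa [ae_iff] using this
  · intro h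
    refine essSup_le_of_ae_le a ?_
    change ∀ᵐ x ∂μ, f x ≤ a
    simpa [ae_iff] using h

/-- The supremum exceeds `a` exactly when the Whitney region meets `{H > a}` in positive measure,
and the measure of sections of a measurable set is measurable. -/
lemma measurable_essSup_whitney {n : ℕ} {H : Pt n → ℝ≥0∞} (hH : Measurable H) :
    Measurable fun q : Pt n => essSup H (volume.restrict (whitney q)) := by
  refine measurable_of_Ioi fun a => ?_
  have hS : MeasurableSet {p | a < H p} := measurableSet_lt measurable_const hH
  have h1 : Measurable fun q : Pt n => volume (Prod.mk q ⁻¹'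
      ({z : Pt n × Pt n | z.2 ∈ whitney z.1} ∩ Prod.snd ⁻¹' {p | a < H p})) :=
    measurable_measure_prodMk_left ((measurableSet_whitneyRel n).inter (measurable_snd hS))
  have h2 : (fun q : Pt n => essSup H (volume.restrict (whitney q))) ⁻¹' Ioi a =
      {q | volume (Prod.mk q ⁻¹'
      ({z : Pt n × Pt n | z.2 ∈ whitney z.1} ∩ Prod.snd ⁻¹' {p | a < H p})) ≠ 0} := by
    ext q
    rw [mem_preimage, mem_Ioi, lt_essSup_iff, Measure.restrict_apply hS, inter_comm]
    rfl
  rw [h2]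
  exact (h1 (measurableSet_singleton 0)).compl

lemma whitneyAvg_mul_le {n : ℕ} (H Φ : Pt n → ℝ≥0∞) (hΦ : Measurable Φ) (q : Pt n) :
    whitneyAvg (fun p => H p * Φ p) q ≤
      essSup H (volume.restrict (whitney q)) * whitneyAvg Φ q := by
  unfold whitneyAvg
  rw [mul_left_comm]
  gcongr
  rw [← lintegral_const_mul _ hΦ]
  refine lintegral_mono_ae ?_
  filter_upwards [ENNReal.ae_le_essSup (μ := volume.restrict (whitney q)) H] with p hp
  gcongr

/-! ### Averaging over Whitney regions -/

lemma volume_box {n : ℕ} (a b : ℝ) (x : EuclideanSpace ℝ (Fin n)) {r : ℝ} (hr : 0 < r) :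
    (volume : Measure (Pt n)) (Ioo a b ×ˢ ball x r) =
      ENNReal.ofReal (b - a) * (ENNReal.ofReal (r ^ n) * unitVol n) := by
  rw [Measure.volume_eq_prod, Measure.prod_prod, Real.volume_Ioo, volume_ball_eq _ hr]

/-- Tonelli. The points `q` whose Whitney region contains `p` lie at height comparable to that of
`p` and fill a volume comparable to `p.1 ^ (n + 1)`, so the weight on the right is bounded above and
below; the next two estimates make this explicit by inscribed and circumscribed boxes. -/
lemma lintegral_whitneyAvg {n : ℕ} {Φ : Pt n → ℝ≥0∞} (hΦ : Measurable Φ) :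
    ∫⁻ q, whitneyAvg Φ q ∂(halfVol n) = ∫⁻ p, Φ p *
      (∫⁻ q in {q | p ∈ whitney q}, (ENNReal.ofReal (q.1 ^ (n + 1)))⁻¹) ∂(halfVol n) := by
  have hrel := measurableSet_whitneyRel n
  have hc : Measurable fun q : Pt n => (ENNReal.ofReal (q.1 ^ (n + 1)))⁻¹ := by fun_prop
  calc ∫⁻ q, whitneyAvg Φ q ∂(halfVol n)
      = ∫⁻ q, whitneyAvg Φ q := by
        rw [halfVol, ← lintegral_indicator (measurableSet_halfSpace n)]
        refine lintegral_congr fun q => ?_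
        by_cases hq : q ∈ halfSpace n
        · rw [indicator_of_mem hq]
        · rw [indicator_of_notMem hq, whitneyAvg_of_nonpos _ (not_lt.1 hq)]
    _ = ∫⁻ q : Pt n, ∫⁻ p : Pt n, {z : Pt n × Pt n | z.2 ∈ whitney z.1}.indicator
          (fun z => (ENNReal.ofReal (z.1.1 ^ (n + 1)))⁻¹ * Φ z.2) (q, p) := by
        refine lintegral_congr fun q => ?_
        rw [whitneyAvg, ← lintegral_const_mul _ hΦ,
          ← lintegral_indicator (measurableSet_whitney q)]
        rfl
    _ = ∫⁻ p : Pt n, ∫⁻ q : Pt n, {z : Pt n × Pt n | z.2 ∈ whitney z.1}.indicator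
          (fun z => (ENNReal.ofReal (z.1.1 ^ (n + 1)))⁻¹ * Φ z.2) (q, p) :=
        lintegral_lintegral_swap (Measurable.aemeasurable
          (((hc.comp measurable_fst).mul (hΦ.comp measurable_snd)).indicator hrel))
    _ = ∫⁻ p, Φ p * ∫⁻ q in {q | p ∈ whitney q}, (ENNReal.ofReal (q.1 ^ (n + 1)))⁻¹ := by
        refine lintegral_congr fun p => ?_
        have hm : MeasurableSet {q : Pt n | p ∈ whitney q} := measurable_prodMk_right hrel
        rw [← lintegral_const_mul _ hc, ← lintegral_indicator hm]
        refine lintegral_congr fun q => ?_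
        simp only [indicator, mem_ofPred_eq, mul_comm]
    _ = _ := by
        rw [halfVol, ← lintegral_indicator (measurableSet_halfSpace n)]
        refine lintegral_congr fun p => ?_
        by_cases hp : p ∈ halfSpace n
        · rw [indicator_of_mem hp]
        · rw [indicator_of_notMem hp]
          have : {q : Pt n | p ∈ whitney q} = ∅ :=
            eq_empty_of_forall_notMem fun q hq => hp (whitney_subset_halfSpace q hq)
          simp [this]

/-- The constant of the lower averaging estimate. -/
def avgLower (n : ℕ) : ℝ≥0∞ := ENNReal.ofReal (2 ^ (n + 1)) * (unitVol n)⁻¹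

/-- The constant of the upper averaging estimate. -/
def avgUpper (n : ℕ) : ℝ≥0∞ := ENNReal.ofReal (4 ^ (n + 1)) * unitVol n

lemma avgLower_ne_top (n : ℕ) : avgLower n ≠ ⊤ :=
  ENNReal.mul_ne_top ENNReal.ofReal_ne_top (ENNReal.inv_ne_top.2 (unitVol_ne_zero n))

lemma avgUpper_ne_top (n : ℕ) : avgUpper n ≠ ⊤ :=
  ENNReal.mul_ne_top ENNReal.ofReal_ne_top (unitVol_ne_top n)

lemma lintegral_le_lintegral_whitneyAvg {n : ℕ} {Φ : Pt n → ℝ≥0∞} (hΦ : Measurable Φ) :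
    ∫⁻ p, Φ p ∂(halfVol n) ≤ avgLower n * ∫⁻ q, whitneyAvg Φ q ∂(halfVol n) := by
  rw [lintegral_whitneyAvg hΦ, ← lintegral_const_mul' _ _ (avgLower_ne_top n)]
  refine setLIntegral_mono' (measurableSet_halfSpace n) fun p hp => ?_
  have hp : 0 < p.1 := hp
  have hsub : Ioo p.1 (2 * p.1) ×ˢ ball p.2 p.1 ⊆ {q | p ∈ whitney q} := by
    rintro q ⟨⟨h1, h2⟩, h3⟩
    rw [mem_ball, dist_comm, dist_eq_norm] at h3
    exact mem_whitney_iff.2 ⟨by linarith, by linarith, by linarith⟩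
  have hlow : ENNReal.ofReal ((2 ^ (n + 1))⁻¹) * unitVol n ≤
      ∫⁻ q in {q | p ∈ whitney q}, (ENNReal.ofReal (q.1 ^ (n + 1)))⁻¹ := by
    calc ENNReal.ofReal ((2 ^ (n + 1))⁻¹) * unitVol n
        = ∫⁻ _ in Ioo p.1 (2 * p.1) ×ˢ ball p.2 p.1,
            ENNReal.ofReal (((2 * p.1) ^ (n + 1))⁻¹) := by
          rw [setLIntegral_const, volume_box _ _ _ hp, ← mul_assoc, ← mul_assoc,
            ← ENNReal.ofReal_mul (by positivity), ← ENNReal.ofReal_mul (by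
              have : 0 ≤ 2 * p.1 - p.1 := by linarith
              positivity)]
          congr 2
          field_simp
          ring
      _ ≤ ∫⁻ q in Ioo p.1 (2 * p.1) ×ˢ ball p.2 p.1, (ENNReal.ofReal (q.1 ^ (n + 1)))⁻¹ := by
          refine setLIntegral_mono' (measurableSet_Ioo.prod measurableSet_ball) ?_
          rintro q ⟨⟨h1, h2⟩, h3⟩
          have hq : 0 < q.1 := hp.trans h1
          rw [← ENNReal.ofReal_inv_of_pos (by positivity)]
          apply ENNReal.ofReal_le_ofReal
          gcongr
      _ ≤ _ := lintegral_mono_set hsub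
  calc Φ p = avgLower n * (Φ p * (ENNReal.ofReal ((2 ^ (n + 1))⁻¹) * unitVol n)) := by
        rw [avgLower, show ∀ a b c d e : ℝ≥0∞, a * b * (c * (d * e)) = c * ((a * d) * (b * e)) by
          intros; ring, ENNReal.inv_mul_cancel (unitVol_ne_zero n) (unitVol_ne_top n),
          ← ENNReal.ofReal_mul (by positivity), mul_inv_cancel₀ (by positivity)]
        simp
    _ ≤ _ := by gcongr

lemma lintegral_whitneyAvg_le {n : ℕ} {Φ : Pt n → ℝ≥0∞} (hΦ : Measurable Φ) :
    ∫⁻ q, whitneyAvg Φ q ∂(halfVol n) ≤ avgUpper n * ∫⁻ p, Φ p ∂(halfVol n) := by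
  rw [lintegral_whitneyAvg hΦ, ← lintegral_const_mul' _ _ (avgUpper_ne_top n)]
  refine setLIntegral_mono' (measurableSet_halfSpace n) fun p hp => ?_
  have hp : 0 < p.1 := hp
  rw [mul_comm (Φ p)]
  gcongr
  have hsub : {q | p ∈ whitney q} ⊆ Ioo (p.1 / 2) (2 * p.1) ×ˢ ball p.2 (2 * p.1) := by
    intro q hq
    obtain ⟨h1, h2, h3⟩ := mem_whitney_iff.1 hq
    refine ⟨⟨by linarith, by linarith⟩, ?_⟩
    rw [mem_ball, dist_comm, dist_eq_norm]
    linarith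
  calc _ ≤ ∫⁻ q in Ioo (p.1 / 2) (2 * p.1) ×ˢ ball p.2 (2 * p.1),
        (ENNReal.ofReal (q.1 ^ (n + 1)))⁻¹ := lintegral_mono_set hsub
    _ ≤ ∫⁻ _ in Ioo (p.1 / 2) (2 * p.1) ×ˢ ball p.2 (2 * p.1),
        ENNReal.ofReal (((p.1 / 2) ^ (n + 1))⁻¹) := by
        refine setLIntegral_mono' (measurableSet_Ioo.prod measurableSet_ball) ?_
        rintro q ⟨⟨h1, h2⟩, h3⟩
        have hq : 0 < q.1 := (half_pos hp).trans h1
        rw [← ENNReal.ofReal_inv_of_pos (by positivity)]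
        apply ENNReal.ofReal_le_ofReal
        gcongr
    _ ≤ avgUpper n := by
        have h0 : 0 ≤ 2 * p.1 - p.1 / 2 := by linarith
        rw [setLIntegral_const, volume_box _ _ _ (by positivity), ← mul_assoc, ← mul_assoc,
          ← ENNReal.ofReal_mul (by positivity), ← ENNReal.ofReal_mul (by positivity), avgUpper]
        gcongr
        calc ((p.1 / 2) ^ (n + 1))⁻¹ * (2 * p.1 - p.1 / 2) * (2 * p.1) ^ n
            ≤ ((p.1 / 2) ^ (n + 1))⁻¹ * (2 * p.1) * (2 * p.1) ^ n := by gcongr; linarith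
          _ = 4 ^ (n + 1) := by
            have : (2 * p.1) = 4 * (p.1 / 2) := by ring
            rw [this, mul_assoc, ← pow_succ', mul_pow]
            field_simp

/-! ### The functionals `A` and `C` -/

lemma measurableSet_coneRel (n : ℕ) :
    MeasurableSet {z : EuclideanSpace ℝ (Fin n) × Pt n | ‖z.2.2 - z.1‖ < z.2.1} :=
  measurableSet_lt (by fun_prop) (by fun_prop)

lemma measurableSet_cone {n : ℕ} (x : EuclideanSpace ℝ (Fin n)) :
    MeasurableSet {p : Pt n | ‖p.2 - x‖ < p.1} :=
  measurable_prodMk_left (measurableSet_coneRel n)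

lemma measurable_areaFun {n : ℕ} {g : Pt n → ℝ≥0∞} (hg : Measurable g) :
    Measurable (areaFun g) := by
  have h1 : Measurable fun x : EuclideanSpace ℝ (Fin n) => ∫⁻ p : Pt n,
      {z : EuclideanSpace ℝ (Fin n) × Pt n | ‖z.2.2 - z.1‖ < z.2.1}.indicator
        (fun z => g z.2 * (ENNReal.ofReal (z.2.1 ^ n))⁻¹) (x, p) :=
    Measurable.lintegral_prod_right' (Measurable.indicator (by fun_prop)
      (measurableSet_coneRel n))
  convert h1 using 2 with x
  rw [areaFun, ← lintegral_indicator (measurableSet_cone x)]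
  rfl

lemma measurable_ballAvg {n : ℕ} {φ : EuclideanSpace ℝ (Fin n) → ℝ≥0∞} (hφ : Measurable φ) :
    Measurable (ballAvg φ) := by
  have hrel : MeasurableSet {z : Pt n × EuclideanSpace ℝ (Fin n) | z.2 ∈ ball z.1.2 z.1.1} := by
    simp_rw [mem_ball]
    exact measurableSet_lt (by fun_prop) (by fun_prop)
  have h1 : Measurable fun p : Pt n => ∫⁻ x : EuclideanSpace ℝ (Fin n),
      {z : Pt n × EuclideanSpace ℝ (Fin n) | z.2 ∈ ball z.1.2 z.1.1}.indicator
        (fun z => φ z.2) (p, x) :=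
    Measurable.lintegral_prod_right' (Measurable.indicator (by fun_prop) hrel)
  have h2 : Measurable fun p : Pt n => ∫⁻ z in ball p.2 p.1, φ z := by
    convert h1 using 2 with p
    rw [← lintegral_indicator measurableSet_ball]
    rfl
  unfold ballAvg
  exact Measurable.mul (by fun_prop) h2

/-- The adjoint of the area functional is the ball average, since `(s, y)` lies in the cone over `x`
exactly when `x` lies in `B(y, s)`. -/
lemma lintegral_areaFun_mul {n : ℕ} {g : Pt n → ℝ≥0∞} (hg : Measurable g)
    {φ : EuclideanSpace ℝ (Fin n) → ℝ≥0∞} (hφ : Measurable φ) :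
    ∫⁻ x, areaFun g x * φ x = ∫⁻ p, g p * ballAvg φ p ∂(halfVol n) := by
  have hrel := measurableSet_coneRel n
  calc ∫⁻ x, areaFun g x * φ x
      = ∫⁻ x : EuclideanSpace ℝ (Fin n), ∫⁻ p : Pt n,
        {z : EuclideanSpace ℝ (Fin n) × Pt n | ‖z.2.2 - z.1‖ < z.2.1}.indicator
          (fun z => g z.2 * (ENNReal.ofReal (z.2.1 ^ n))⁻¹ * φ z.1) (x, p) := by
        refine lintegral_congr fun x => ?_
        rw [areaFun, ← lintegral_mul_const _ (by fun_prop),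
          ← lintegral_indicator (measurableSet_cone x)]
        rfl
    _ = ∫⁻ p : Pt n, ∫⁻ x : EuclideanSpace ℝ (Fin n),
        {z : EuclideanSpace ℝ (Fin n) × Pt n | ‖z.2.2 - z.1‖ < z.2.1}.indicator
          (fun z => g z.2 * (ENNReal.ofReal (z.2.1 ^ n))⁻¹ * φ z.1) (x, p) :=
        lintegral_lintegral_swap (Measurable.aemeasurable
          (Measurable.indicator (by fun_prop) hrel))
    _ = ∫⁻ p, g p * ballAvg φ p := by
        refine lintegral_congr fun p => ?_
        rw [ballAvg, ← mul_assoc, ← lintegral_const_mul _ hφ,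
          ← lintegral_indicator measurableSet_ball]
        refine lintegral_congr fun x => ?_
        simp only [indicator, mem_ofPred_eq, mem_ball, dist_comm x, dist_eq_norm]
    _ = _ := by
        rw [halfVol, ← lintegral_indicator (measurableSet_halfSpace n)]
        refine lintegral_congr fun p => ?_
        by_cases hp : p ∈ halfSpace n
        · rw [indicator_of_mem hp]
        · rw [indicator_of_notMem hp]
          simp [ballAvg, ball_eq_empty.2 (not_lt.1 hp)]

/-- Points of the tent have their whole shadow inside `B(x, r)`, so the ball average of the
indicator of `B(x, r)` is the full unit volume there. -/
lemma lintegral_tent_le {n : ℕ} {g : Pt n → ℝ≥0∞} (hg : Measurable g)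
    (x : EuclideanSpace ℝ (Fin n)) (r : ℝ) :
    ∫⁻ p in tent x r, g p ≤ (unitVol n)⁻¹ * ∫⁻ z in ball x r, areaFun g z := by
  have hω := unitVol_ne_zero n
  have hω' := unitVol_ne_top n
  have h1 : ∫⁻ z in ball x r, areaFun g z =
      ∫⁻ p, g p * ballAvg ((ball x r).indicator 1) p ∂(halfVol n) := by
    rw [← lintegral_areaFun_mul hg (measurable_one.indicator measurableSet_ball),
      ← lintegral_indicator measurableSet_ball]
    refine lintegral_congr fun z => ?_
    simp [indicator]
  have hsub : tent x r ⊆ halfSpace n := fun p hp => hp.1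
  have h2 : ∀ p ∈ tent x r, unitVol n ≤ ballAvg ((ball x r).indicator 1) p := by
    rintro p ⟨hp0, hp⟩
    have hb : ball p.2 p.1 ⊆ ball x r := ball_subset_ball' (by rw [dist_eq_norm]; linarith)
    rw [ballAvg, setLIntegral_congr_fun measurableSet_ball
      (g := fun _ => (1 : ℝ≥0∞)) fun z hz => by simp [indicator_of_mem (hb hz)],
      setLIntegral_const, one_mul, volume_ball_eq _ hp0, ← mul_assoc,
      ENNReal.inv_mul_cancel (ofReal_pow_ne_zero hp0 n) ENNReal.ofReal_ne_top, one_mul]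
  calc ∫⁻ p in tent x r, g p = (unitVol n)⁻¹ * ∫⁻ p in tent x r, g p * unitVol n := by
        rw [lintegral_mul_const _ hg, mul_comm (∫⁻ p in tent x r, g p), ← mul_assoc,
          ENNReal.inv_mul_cancel hω hω', one_mul]
    _ ≤ (unitVol n)⁻¹ * ∫⁻ p in tent x r, g p * ballAvg ((ball x r).indicator 1) p := by
        gcongr 1
        exact setLIntegral_mono' (measurableSet_tent x r) fun p hp => by gcongr; exact h2 p hp
    _ ≤ _ := by
        rw [h1]
        gcongr 1
        exact lintegral_mono_set hsub

lemma carlesonFun_eq {n : ℕ} (g : Pt n → ℝ≥0∞) (x : EuclideanSpace ℝ (Fin n)) :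
    carlesonFun g x = ⨆ (r : ℝ) (_ : 0 < r),
      (ENNReal.ofReal (r ^ n))⁻¹ * ∫⁻ p in tent x r, g p := rfl

lemma carlesonFun_le_maximal {n : ℕ} {g : Pt n → ℝ≥0∞} (hg : Measurable g)
    (x : EuclideanSpace ℝ (Fin n)) :
    carlesonFun g x ≤ (unitVol n)⁻¹ * nonTangMax (ballAvg (areaFun g)) x := by
  rw [carlesonFun_eq]
  refine iSup₂_le fun r hr => ?_
  calc _ ≤ (ENNReal.ofReal (r ^ n))⁻¹ *
        ((unitVol n)⁻¹ * ∫⁻ z in ball x r, areaFun g z) := by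
        gcongr; exact lintegral_tent_le hg x r
    _ = (unitVol n)⁻¹ * ballAvg (areaFun g) (r, x) := by rw [ballAvg]; ring
    _ ≤ _ := by
        gcongr
        exact le_nonTangMax _ (by simpa using hr)

lemma lintegral_tent_le_of_carlesonFun {n : ℕ} (g : Pt n → ℝ≥0∞)
    (x : EuclideanSpace ℝ (Fin n)) {r : ℝ} (hr : 0 < r) :
    ∫⁻ p in tent x r, g p ≤ carlesonFun g x * ENNReal.ofReal (r ^ n) := by
  have h1 : (ENNReal.ofReal (r ^ n))⁻¹ * ∫⁻ p in tent x r, g p ≤ carlesonFun g x :=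
    le_iSup₂ (f := fun (r : ℝ) (_ : 0 < r) =>
      (ENNReal.ofReal (r ^ n))⁻¹ * ∫⁻ p in tent x r, g p) r hr
  rw [mul_comm, ← div_eq_mul_inv, ENNReal.div_le_iff (ofReal_pow_ne_zero hr n)
    ENNReal.ofReal_ne_top] at h1
  exact h1

lemma tent_subset_tent {n : ℕ} {x z : EuclideanSpace ℝ (Fin n)} {r R : ℝ}
    (h : ‖x - z‖ + r ≤ R) : tent x r ⊆ tent z R := by
  rintro p ⟨hp0, hp⟩
  have := norm_sub_le_norm_sub_add_norm_sub p.2 x z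
  exact ⟨hp0, by linarith⟩

/-- The essential supremum controls `C g` only almost everywhere. A good centre `z` exists in `B(x,
r)`, and the tent over `x` lies in the tent of doubled radius over `z`, which costs `2 ^ n`. -/
lemma lintegral_tent_le_of_essSup {n : ℕ} (g : Pt n → ℝ≥0∞)
    (x : EuclideanSpace ℝ (Fin n)) {r : ℝ} (hr : 0 < r) :
    ∫⁻ p in tent x r, g p ≤
      ENNReal.ofReal (2 ^ n) * eLpNorm (carlesonFun g) ⊤ volume * ENNReal.ofReal (r ^ n) := by
  have hae : ∀ᵐ z ∂(volume : Measure (EuclideanSpace ℝ (Fin n))),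
      carlesonFun g z ≤ eLpNorm (carlesonFun g) ⊤ volume := by
    rw [eLpNorm_exponent_top]
    exact ENNReal.ae_le_essSup (carlesonFun g)
  obtain ⟨z, hz, hzb⟩ : ∃ z, carlesonFun g z ≤ eLpNorm (carlesonFun g) ⊤ volume ∧
      z ∈ ball x r := by
    by_contra! hcon
    have : volume (ball x r) = 0 :=
      measure_mono_null (fun z hz hz' => hcon z hz' hz) (ae_iff.1 hae)
    exact (measure_ball_pos _ x hr).ne' this
  rw [mem_ball, dist_comm, dist_eq_norm] at hzb
  calc ∫⁻ p in tent x r, g p ≤ ∫⁻ p in tent z (2 * r), g p :=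
        lintegral_mono_set (tent_subset_tent (by linarith))
    _ ≤ carlesonFun g z * ENNReal.ofReal ((2 * r) ^ n) :=
        lintegral_tent_le_of_carlesonFun g z (by positivity)
    _ ≤ eLpNorm (carlesonFun g) ⊤ volume * ENNReal.ofReal ((2 * r) ^ n) := by gcongr
    _ = _ := by rw [mul_pow, ENNReal.ofReal_mul (by positivity)]; ring

/-! ### Upper bounds by the Carleson-Dahlberg norm -/

variable {n m : ℕ}

lemma normN_sq (f : Pt n → Val n m) :
    normN f ^ 2 = ∫⁻ x, nonTangMax (whitneyTwo f) x ^ 2 := by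
  rw [normN, eLpNorm_two_sq]; rfl

lemma normC_sq (f : Pt n → Val n m) :
    normC f ^ 2 = ∫⁻ x, carlesonFun (whitneyTwo f) x ^ 2 := by
  rw [normC, eLpNorm_two_sq]; rfl

lemma normA_sq (f : Pt n → Val n m) :
    normA f ^ 2 = ∫⁻ x, areaFun (whitneyTwo f) x ^ 2 := by
  rw [normA, eLpNorm_two_sq]; rfl

lemma normL2_sq (α : ℝ) (f : Pt n → Val n m) :
    normL2 α f ^ 2 = ∫⁻ p, ‖f p‖ₑ ^ 2 * ENNReal.ofReal (p.1 ^ α) ∂(halfVol n) := by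
  rw [normL2, rpow_half_sq]

lemma carlesonDahlberg_sq (E : Pt n → (Val n m →L[ℂ] Val n m)) :
    carlesonDahlberg E ^ 2 =
      eLpNorm (carlesonFun (whitneySup fun p : Pt n => ‖E p‖ ^ 2 / p.1)) ⊤ volume := by
  rw [carlesonDahlberg, rpow_half_sq]

/-- The constant of the comparison of `C` with `A`. -/
def areaConst (n : ℕ) : ℝ≥0∞ := (unitVol n)⁻¹ ^ 2 * maxConst n

lemma areaConst_ne_top (n : ℕ) : areaConst n ≠ ⊤ :=
  ENNReal.mul_ne_top (ENNReal.pow_ne_top (ENNReal.inv_ne_top.2 (unitVol_ne_zero n)))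
    (maxConst_ne_top n)

theorem normC_sq_le (hn : 1 ≤ n) {f : Pt n → Val n m} (hf : StronglyMeasurable f) :
    normC f ^ 2 ≤ areaConst n * normA f ^ 2 := by
  have hw : Measurable (whitneyTwo f) := measurable_whitneyTwo hf.enorm
  have hc : (unitVol n)⁻¹ ^ 2 ≠ ⊤ :=
    ENNReal.pow_ne_top (ENNReal.inv_ne_top.2 (unitVol_ne_zero n))
  rw [normC_sq, normA_sq]
  calc ∫⁻ x, carlesonFun (whitneyTwo f) x ^ 2
      ≤ ∫⁻ x, (unitVol n)⁻¹ ^ 2 * nonTangMax (ballAvg (areaFun (whitneyTwo f))) x ^ 2 := by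
        refine lintegral_mono fun x => ?_
        rw [← mul_pow]
        exact pow_le_pow_left' (carlesonFun_le_maximal hw x) 2
    _ = (unitVol n)⁻¹ ^ 2 * ∫⁻ x, nonTangMax (ballAvg (areaFun (whitneyTwo f))) x ^ 2 :=
        lintegral_const_mul' _ _ hc
    _ ≤ (unitVol n)⁻¹ ^ 2 * (maxConst n * ∫⁻ x, areaFun (whitneyTwo f) x ^ 2) := by
        gcongr
        exact lintegral_sq_maximal_le hn _ (measurable_areaFun hw)
    _ = _ := by rw [areaConst, mul_assoc]

/-- The density `|E|²/t`. -/
def dens (E : Pt n → (Val n m →L[ℂ] Val n m)) (p : Pt n) : ℝ≥0∞ := ‖‖E p‖ ^ 2 / p.1‖ₑ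

lemma measurable_dens {E : Pt n → (Val n m →L[ℂ] Val n m)} (hE : StronglyMeasurable E) :
    Measurable (dens E) := by
  have h : Measurable fun p => ‖E p‖ := hE.norm.measurable
  unfold dens
  fun_prop

lemma dens_mul {E : Pt n → (Val n m →L[ℂ] Val n m)} {p : Pt n} (hp : 0 < p.1) :
    dens E p * ENNReal.ofReal p.1 = ‖E p‖ₑ ^ 2 := by
  have h0 : 0 ≤ ‖E p‖ ^ 2 / p.1 := by positivity
  rw [dens, Real.enorm_of_nonneg h0, ← ENNReal.ofReal_mul h0, div_mul_cancel₀ _ hp.ne',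
    ENNReal.ofReal_pow (norm_nonneg _), ofReal_norm]

lemma enorm_mult_sq_le (E : Pt n → (Val n m →L[ℂ] Val n m)) (f : Pt n → Val n m) {p : Pt n}
    (hp : 0 < p.1) :
    ‖mult E f p‖ₑ ^ 2 ≤ dens E p * (‖f p‖ₑ ^ 2 * ENNReal.ofReal (p.1 ^ (1 : ℝ))) := by
  rw [Real.rpow_one, mul_comm (‖f p‖ₑ ^ 2), ← mul_assoc, dens_mul hp, ← mul_pow]
  exact pow_le_pow_left' ((E p).le_opENorm (f p)) 2

lemma stronglyMeasurable_mult {E : Pt n → (Val n m →L[ℂ] Val n m)} (hE : StronglyMeasurable E)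
    {f : Pt n → Val n m} (hf : StronglyMeasurable f) : StronglyMeasurable (mult E f) :=
  isBoundedBilinearMap_apply.continuous.comp_stronglyMeasurable (hE.prodMk hf)

lemma lintegral_tent_whitneySup_le (E : Pt n → (Val n m →L[ℂ] Val n m))
    (x : EuclideanSpace ℝ (Fin n)) (r : ℝ) (hr : 0 < r) :
    ∫⁻ q in tent x r, essSup (dens E) (volume.restrict (whitney q)) ≤
      ENNReal.ofReal (2 ^ n) * carlesonDahlberg E ^ 2 * ENNReal.ofReal (r ^ n) := by
  rw [carlesonDahlberg_sq]
  exact lintegral_tent_le_of_essSup _ x hr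

/-- The constant of the bound `N_{2,2} → L_2(t^{-1})`. -/
def upperN (n : ℕ) : ℝ≥0∞ := avgLower n * (ENNReal.ofReal (2 ^ n) * embConst n)

lemma upperN_ne_top (n : ℕ) : upperN n ≠ ⊤ :=
  ENNReal.mul_ne_top (avgLower_ne_top n)
    (ENNReal.mul_ne_top ENNReal.ofReal_ne_top (embConst_ne_top n))

/-- Averaging first over Whitney regions replaces the pointwise density by its Whitney supremum and
`|f|²` by `(W_2 f)²`; these are the two factors of Carleson's embedding. -/
theorem normL2_mult_sq_le (hn : 1 ≤ n) {E : Pt n → (Val n m →L[ℂ] Val n m)}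
    (hE : StronglyMeasurable E) (hfin : carlesonDahlberg E ≠ ⊤) {f : Pt n → Val n m}
    (hf : StronglyMeasurable f) :
    normL2 (-1) (mult E f) ^ 2 ≤ upperN n * carlesonDahlberg E ^ 2 * normN f ^ 2 := by
  set G : Pt n → ℝ≥0∞ := fun q => essSup (dens E) (volume.restrict (whitney q))
  have hdm := measurable_dens hE
  have hfm : Measurable fun p => ‖f p‖ₑ ^ 2 := hf.enorm.pow_const 2
  have hK : ENNReal.ofReal (2 ^ n) * carlesonDahlberg E ^ 2 ≠ ⊤ :=
    ENNReal.mul_ne_top ENNReal.ofReal_ne_top (ENNReal.pow_ne_top hfin)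
  rw [normL2_sq, normN_sq]
  calc ∫⁻ p, ‖mult E f p‖ₑ ^ 2 * ENNReal.ofReal (p.1 ^ (-1 : ℝ)) ∂(halfVol n)
      ≤ ∫⁻ p, dens E p * ‖f p‖ₑ ^ 2 ∂(halfVol n) := by
        refine setLIntegral_mono' (measurableSet_halfSpace n) fun p hp => ?_
        have hp : 0 < p.1 := hp
        calc _ ≤ dens E p * (‖f p‖ₑ ^ 2 * ENNReal.ofReal (p.1 ^ (1 : ℝ))) *
              ENNReal.ofReal (p.1 ^ (-1 : ℝ)) := by gcongr; exact enorm_mult_sq_le E f hp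
          _ = dens E p * ‖f p‖ₑ ^ 2 * ENNReal.ofReal (p.1 ^ (1 : ℝ) * p.1 ^ (-1 : ℝ)) := by
            rw [ENNReal.ofReal_mul (by positivity)]; ring
          _ = _ := by
            rw [← Real.rpow_add hp]; simp
    _ ≤ avgLower n * ∫⁻ q, whitneyAvg (fun p => dens E p * ‖f p‖ₑ ^ 2) q ∂(halfVol n) :=
        lintegral_le_lintegral_whitneyAvg (hdm.mul hfm)
    _ ≤ avgLower n * ∫⁻ q, G q * whitneyTwo f q ^ 2 ∂(halfVol n) := by
        gcongr with q
        rw [whitneyTwo_sq]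
        exact whitneyAvg_mul_le _ _ hfm q
    _ ≤ avgLower n * (ENNReal.ofReal (2 ^ n) * carlesonDahlberg E ^ 2 * embConst n *
          ∫⁻ x, nonTangMax (fun q => whitneyTwo f q ^ 2) x) := by
        gcongr
        exact carleson_embedding hn (measurable_essSup_whitney hdm)
          ((measurable_whitneyTwo hf.enorm).pow_const 2) hK (lintegral_tent_whitneySup_le E)
    _ ≤ avgLower n * (ENNReal.ofReal (2 ^ n) * carlesonDahlberg E ^ 2 * embConst n *
          ∫⁻ x, nonTangMax (whitneyTwo f) x ^ 2) := by
        gcongr with x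
        exact nonTangMax_sq_le _ x
    _ = _ := by rw [upperN]; ring

/-- The constant of the bound `L_2(t) → C_{2,2}`. -/
def upperA (n : ℕ) : ℝ≥0∞ := ENNReal.ofReal (2 ^ n) * embConst n * maxConst n * avgUpper n

lemma upperA_ne_top (n : ℕ) : upperA n ≠ ⊤ :=
  ENNReal.mul_ne_top (ENNReal.mul_ne_top (ENNReal.mul_ne_top ENNReal.ofReal_ne_top
    (embConst_ne_top n)) (maxConst_ne_top n)) (avgUpper_ne_top n)

/-- Duality moves the area functional onto ball averages of `φ`. Cauchy-Schwarz then separates `G`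
with these averages (embedding plus maximal theorem) from the Whitney averages of `t|f|²`. -/
theorem normA_mult_sq_le (hn : 1 ≤ n) {E : Pt n → (Val n m →L[ℂ] Val n m)}
    (hE : StronglyMeasurable E) (hfin : carlesonDahlberg E ≠ ⊤) {f : Pt n → Val n m}
    (hf : StronglyMeasurable f) :
    normA (mult E f) ^ 2 ≤ upperA n * carlesonDahlberg E ^ 2 * normL2 1 f ^ 2 := by
  set G : Pt n → ℝ≥0∞ := fun q => essSup (dens E) (volume.restrict (whitney q))
  have hdm := measurable_dens hE
  have hGm : Measurable G := measurable_essSup_whitney hdm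
  set Φ : Pt n → ℝ≥0∞ := fun p => ‖f p‖ₑ ^ 2 * ENNReal.ofReal (p.1 ^ (1 : ℝ)) with hΦ_def
  have hΦ : Measurable Φ := by
    have := hf.enorm
    fun_prop
  have hUm := measurable_whitneyAvg hΦ
  set w := whitneyTwo (mult E f)
  have hwm : Measurable w := measurable_whitneyTwo (stronglyMeasurable_mult hE hf).enorm
  have hK : ENNReal.ofReal (2 ^ n) * carlesonDahlberg E ^ 2 ≠ ⊤ :=
    ENNReal.mul_ne_top ENNReal.ofReal_ne_top (ENNReal.pow_ne_top hfin)
  have hw : ∀ q, w q ≤ G q ^ (1 / 2 : ℝ) * whitneyAvg Φ q ^ (1 / 2 : ℝ) := by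
    intro q
    have h1 : w q ^ 2 ≤ G q * whitneyAvg Φ q := by
      refine le_trans ?_ (whitneyAvg_mul_le (dens E) Φ hΦ q)
      rw [whitneyTwo_sq]
      unfold whitneyAvg
      gcongr 1
      exact setLIntegral_mono' (measurableSet_whitney q) fun p hp =>
        enorm_mult_sq_le E f (pos_of_mem_whitney' hp)
    rw [← ENNReal.mul_rpow_of_nonneg _ _ (by norm_num)]
    calc w q = (w q ^ 2) ^ (1 / 2 : ℝ) := by
          rw [← ENNReal.rpow_two, ← ENNReal.rpow_mul]; norm_num
      _ ≤ _ := ENNReal.rpow_le_rpow h1 (by norm_num)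
  rw [normA_sq, normL2_sq]
  refine lintegral_sq_le_of_dual (measurable_areaFun hwm) fun φ hφ => ?_
  have hP := measurable_ballAvg hφ
  have hemb : ∫⁻ p, G p * ballAvg φ p ^ 2 ∂(halfVol n) ≤
      ENNReal.ofReal (2 ^ n) * carlesonDahlberg E ^ 2 * embConst n *
        (maxConst n * ∫⁻ x, φ x ^ 2) := by
    refine (carleson_embedding hn hGm (hP.pow_const 2) hK
      (lintegral_tent_whitneySup_le E)).trans ?_
    gcongr
    exact (lintegral_mono (nonTangMax_sq_le _)).trans (lintegral_sq_maximal_le hn φ hφ)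
  calc (∫⁻ x, areaFun w x * φ x) ^ 2 = (∫⁻ p, w p * ballAvg φ p ∂(halfVol n)) ^ 2 := by
        rw [lintegral_areaFun_mul hwm hφ]
    _ ≤ (∫⁻ p, (G p ^ (1 / 2 : ℝ) * ballAvg φ p) * whitneyAvg Φ p ^ (1 / 2 : ℝ)
          ∂(halfVol n)) ^ 2 := by
        refine pow_le_pow_left' (lintegral_mono fun p => ?_) 2
        calc w p * ballAvg φ p ≤ G p ^ (1 / 2 : ℝ) * whitneyAvg Φ p ^ (1 / 2 : ℝ) *
              ballAvg φ p := by gcongr; exact hw p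
          _ = _ := by ring
    _ ≤ (∫⁻ p, (G p ^ (1 / 2 : ℝ) * ballAvg φ p) ^ 2 ∂(halfVol n)) *
          ∫⁻ p, (whitneyAvg Φ p ^ (1 / 2 : ℝ)) ^ 2 ∂(halfVol n) :=
        lintegral_mul_sq_le ((hGm.pow_const _).mul hP).aemeasurable
          (hUm.pow_const _).aemeasurable
    _ = (∫⁻ p, G p * ballAvg φ p ^ 2 ∂(halfVol n)) * ∫⁻ p, whitneyAvg Φ p ∂(halfVol n) := by
        simp_rw [mul_pow, rpow_half_sq]
    _ ≤ ENNReal.ofReal (2 ^ n) * carlesonDahlberg E ^ 2 * embConst n *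
          (maxConst n * ∫⁻ x, φ x ^ 2) * (avgUpper n * ∫⁻ p, Φ p ∂(halfVol n)) := by
        gcongr
        exact lintegral_whitneyAvg_le hΦ
    _ = _ := by rw [upperA]; ring

/-! ### A Whitney grid of the half space -/

/-- Indices of the grid: the scale and the position. -/
abbrev CubeIdx (n : ℕ) : Type := ℤ × (Fin n → ℤ)

/-- The scale `2^k` of a grid cell. -/
def scale (i : CubeIdx n) : ℝ := 2 ^ i.1

/-- The grid cell `[2^k, 2^{k+1}) × ∏ [z_j 2^k/n, (z_j + 1) 2^k/n)`. -/
def cube (i : CubeIdx n) : Set (Pt n) :=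
  {p | (scale i ≤ p.1 ∧ p.1 < 2 * scale i) ∧
    ∀ j, i.2 j * (scale i / n) ≤ p.2 j ∧ p.2 j < (i.2 j + 1) * (scale i / n)}

/-- The corner of a grid cell. -/
def corner (i : CubeIdx n) : EuclideanSpace ℝ (Fin n) :=
  WithLp.toLp 2 fun j => i.2 j * (scale i / n)

lemma scale_pos (i : CubeIdx n) : 0 < scale i := by unfold scale; positivity

lemma cube_subset_halfSpace (i : CubeIdx n) : cube i ⊆ halfSpace n :=
  fun _ hp => (scale_pos i).trans_le hp.1.1

lemma cube_eq_prod (i : CubeIdx n) :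
    cube i = Ico (scale i) (2 * scale i) ×ˢ
      ((MeasurableEquiv.toLp 2 (Fin n → ℝ)).symm ⁻¹' (Set.univ.pi fun j =>
        Ico (i.2 j * (scale i / n)) ((i.2 j + 1) * (scale i / n)))) := by
  ext p
  simp only [cube, mem_ofPred_eq, mem_prod, mem_Ico, mem_preimage, mem_univ_pi]
  rfl

lemma measurableSet_cube (i : CubeIdx n) : MeasurableSet (cube i) := by
  rw [cube_eq_prod]
  exact measurableSet_Ico.prod ((MeasurableEquiv.measurable _)
    (MeasurableSet.univ_pi fun _ => measurableSet_Ico))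

lemma volume_cube (i : CubeIdx n) :
    volume (cube i) = ENNReal.ofReal (scale i ^ (n + 1) * ((n : ℝ)⁻¹) ^ n) := by
  have hs := scale_pos i
  rw [cube_eq_prod, Measure.volume_eq_prod, Measure.prod_prod, Real.volume_Ico,
    (EuclideanSpace.volume_preserving_symm_measurableEquiv_toLp (Fin n)).measure_preimage
      (MeasurableSet.univ_pi fun _ => measurableSet_Ico).nullMeasurableSet, Real.volume_pi_Ico]
  have : ∀ j, (i.2 j + 1 : ℝ) * (scale i / n) - i.2 j * (scale i / n) = scale i * (n : ℝ)⁻¹ :=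
    fun j => by ring
  simp_rw [this]
  rw [Finset.prod_const, Finset.card_univ, Fintype.card_fin, ← ENNReal.ofReal_pow (by positivity),
    ← ENNReal.ofReal_mul (by linarith)]
  congr 1
  ring

lemma volume_cube_ne_zero (hn : 1 ≤ n) (i : CubeIdx n) : volume (cube i) ≠ 0 := by
  have hs := scale_pos i
  have hn' : (0 : ℝ) < n := by exact_mod_cast hn
  rw [volume_cube]
  have : 0 < scale i ^ (n + 1) * ((n : ℝ)⁻¹) ^ n := by positivity
  simpa using this

lemma volume_cube_ne_top (i : CubeIdx n) : volume (cube i) ≠ ⊤ := by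
  rw [volume_cube]; exact ENNReal.ofReal_ne_top

/-- The side `scale i / n` is chosen for this: the Euclidean diameter is at most `√n · scale i / n ≤
scale i`, so a cell lies in the Whitney region of each of its points. -/
lemma norm_sub_lt_scale (hn : 1 ≤ n) {i : CubeIdx n} {p q : Pt n} (hp : p ∈ cube i)
    (hq : q ∈ cube i) : ‖p.2 - q.2‖ < scale i := by
  have hs := scale_pos i
  have hn' : (1 : ℝ) ≤ n := by exact_mod_cast hn
  have hne : (Finset.univ : Finset (Fin n)).Nonempty := ⟨⟨0, hn⟩, Finset.mem_univ _⟩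
  rw [EuclideanSpace.norm_eq, Real.sqrt_lt' hs]
  calc ∑ j, ‖(p.2 - q.2) j‖ ^ 2 < ∑ _j : Fin n, (scale i / n) ^ 2 := by
        refine Finset.sum_lt_sum_of_nonempty hne fun j _ => ?_
        have h1 := hp.2 j
        have h2 := hq.2 j
        rw [Real.norm_eq_abs, sq_abs, PiLp.sub_apply]
        have h3 : |p.2 j - q.2 j| < scale i / n := by
          rw [abs_lt]; constructor <;> nlinarith
        exact sq_lt_sq.2 (h3.trans_le (le_abs_self _))
    _ = scale i ^ 2 / n := by
        rw [Finset.sum_const, Finset.card_univ, Fintype.card_fin, nsmul_eq_mul]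
        field_simp
    _ ≤ scale i ^ 2 := div_le_self (by positivity) hn'

lemma corner_mem_cube (hn : 1 ≤ n) (i : CubeIdx n) : (scale i, corner i) ∈ cube i := by
  have hs := scale_pos i
  have hn' : (0 : ℝ) < n := by exact_mod_cast hn
  have : 0 < scale i / n := by positivity
  refine ⟨⟨le_rfl, by linarith⟩, fun j => ⟨le_rfl, ?_⟩⟩
  simp only [corner]
  linarith

lemma cube_subset_whitney (hn : 1 ≤ n) {i : CubeIdx n} {q : Pt n} (hq : q ∈ cube i) :
    cube i ⊆ whitney q := fun p hp => by
  have h := norm_sub_lt_scale hn hp hq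
  have h1 := hp.1
  have h2 := hq.1
  exact mem_whitney_iff.2 ⟨by linarith, by linarith, by linarith⟩

lemma exists_mem_cube (hn : 1 ≤ n) {p : Pt n} (hp : 0 < p.1) :
    ∃ i : CubeIdx n, p ∈ cube i := by
  have hn' : (0 : ℝ) < n := by exact_mod_cast hn
  obtain ⟨k, hk1, hk2⟩ := exists_mem_Ico_zpow hp one_lt_two
  have hs : (0 : ℝ) < 2 ^ k / n := by positivity
  refine ⟨(k, fun j => ⌊p.2 j / (2 ^ k / n)⌋), ⟨hk1, ?_⟩, fun j => ⟨?_, ?_⟩⟩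
  · rw [zpow_add_one₀ two_ne_zero] at hk2
    simp only [scale]; linarith
  · simp only [scale]
    rw [← le_div_iff₀ hs]
    exact Int.floor_le _
  · simp only [scale]
    rw [← div_lt_iff₀ hs]
    exact Int.lt_floor_add_one _

lemma cube_disjoint (hn : 1 ≤ n) {i j : CubeIdx n} (hij : i ≠ j) :
    Disjoint (cube i) (cube j) := by
  rw [Set.disjoint_left]
  intro p hi hj
  apply hij
  have hn' : (0 : ℝ) < n := by exact_mod_cast hn
  have key : ∀ i j : CubeIdx n, p ∈ cube i → p ∈ cube j → i.1 ≤ j.1 := by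
    intro i j hi hj
    have h : (2 : ℝ) ^ i.1 < 2 ^ (j.1 + 1) := by
      rw [zpow_add_one₀ two_ne_zero]
      have h1 := hi.1.1
      have h2 := hj.1.2
      simp only [scale] at h1 h2
      linarith
    have := (zpow_lt_zpow_iff_right₀ one_lt_two).1 h
    omega
  have h1 : i.1 = j.1 := le_antisymm (key i j hi hj) (key j i hj hi)
  have hs : scale i = scale j := by simp [scale, h1]
  refine Prod.ext h1 (funext fun l => ?_)
  have hi2 := hi.2 l
  have hj2 := hj.2 l
  rw [hs] at hi2
  have hpos : 0 < scale j / n := div_pos (scale_pos j) hn'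
  have a1 : (i.2 l : ℝ) < j.2 l + 1 := lt_of_mul_lt_mul_right (hi2.1.trans_lt hj2.2) hpos.le
  have a2 : (j.2 l : ℝ) < i.2 l + 1 := lt_of_mul_lt_mul_right (hj2.1.trans_lt hi2.2) hpos.le
  have b1 : i.2 l < j.2 l + 1 := by exact_mod_cast a1
  have b2 : j.2 l < i.2 l + 1 := by exact_mod_cast a2
  omega

/-- A box containing the points whose Whitney region meets a given cell. -/
def near (i : CubeIdx n) : Set (Pt n) :=
  Ioo (scale i / 2) (4 * scale i) ×ˢ ball (corner i) (5 * scale i)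

lemma mem_near_iff {i : CubeIdx n} {q : Pt n} : q ∈ near i ↔
    (scale i / 2 < q.1 ∧ q.1 < 4 * scale i) ∧ ‖q.2 - corner i‖ < 5 * scale i := by
  rw [near, mem_prod, mem_Ioo, mem_ball, dist_eq_norm]

lemma norm_sub_corner_lt (hn : 1 ≤ n) {i : CubeIdx n} {p : Pt n} (hp : p ∈ cube i) :
    ‖p.2 - corner i‖ < scale i := by
  obtain ⟨q, hq⟩ : ∃ q : Pt n, q = (scale i, corner i) := ⟨_, rfl⟩
  have h1 : q.2 = corner i := by rw [hq]
  have h2 : q ∈ cube i := by rw [hq]; exact corner_mem_cube hn i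
  rw [← h1]
  exact norm_sub_lt_scale hn hp h2

lemma mem_near (hn : 1 ≤ n) {i : CubeIdx n} {p q : Pt n} (hp : p ∈ cube i)
    (hpq : p ∈ whitney q) : q ∈ near i := by
  obtain ⟨h1, h2, h3⟩ := mem_whitney_iff.1 hpq
  have h4 := norm_sub_corner_lt hn hp
  obtain ⟨h5, h6⟩ := hp.1
  have h7 := norm_sub_le_norm_sub_add_norm_sub q.2 p.2 (corner i)
  rw [norm_sub_rev] at h3
  have h8 : scale i / 2 < q.1 := by linarith
  have h9 : q.1 < 4 * scale i := by linarith
  exact mem_near_iff.2 ⟨⟨h8, h9⟩, by linarith⟩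

/-- Since `scale i < 2 * q.1` and `q.1 < r`, moving from `q` to a point of the cell changes height
and position by a bounded multiple of `r`; the factor `17` leaves some room. -/
lemma cube_subset_tent_of_near (hn : 1 ≤ n) {i : CubeIdx n} {q : Pt n}
    {x : EuclideanSpace ℝ (Fin n)} {r : ℝ} (hq : q ∈ near i) (hqx : q ∈ tent x r) :
    cube i ⊆ tent x (17 * r) := by
  intro p hp
  obtain ⟨⟨h1, h2⟩, h3⟩ := mem_near_iff.1 hq
  obtain ⟨h4, h5⟩ := hqx
  have h6 := norm_sub_corner_lt hn hp
  rw [norm_sub_rev] at h3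
  have h7 := norm_sub_le_norm_sub_add_norm_sub p.2 (corner i) x
  have h8 := norm_sub_le_norm_sub_add_norm_sub (corner i) q.2 x
  have h9 := norm_nonneg (q.2 - x)
  obtain ⟨h10, h11⟩ := hp.1
  have h12 : ‖p.2 - x‖ < 17 * r - p.1 := by linarith
  exact ⟨cube_subset_halfSpace i hp, h12⟩

/-- The ratio of the volumes of `near i` and of the cell. -/
def nearConst (n : ℕ) : ℝ≥0∞ := ENNReal.ofReal (4 * 5 ^ n * n ^ n) * unitVol n

lemma nearConst_ne_top (n : ℕ) : nearConst n ≠ ⊤ :=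
  ENNReal.mul_ne_top ENNReal.ofReal_ne_top (unitVol_ne_top n)

lemma volume_near_le (hn : 1 ≤ n) (i : CubeIdx n) :
    volume (near i) ≤ nearConst n * volume (cube i) := by
  have hs := scale_pos i
  have hn' : (0 : ℝ) < n := by exact_mod_cast hn
  have h1 : (4 * scale i - scale i / 2) * (5 * scale i) ^ n ≤
      4 * 5 ^ n * n ^ n * (scale i ^ (n + 1) * ((n : ℝ)⁻¹) ^ n) := by
    calc (4 * scale i - scale i / 2) * (5 * scale i) ^ n
        ≤ (4 * scale i) * (5 * scale i) ^ n := by gcongr; linarith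
      _ = 4 * 5 ^ n * n ^ n * (scale i ^ (n + 1) * ((n : ℝ)⁻¹) ^ n) := by
        rw [inv_pow]
        field_simp
        ring
  have h2 : 0 ≤ 4 * scale i - scale i / 2 := by linarith
  calc volume (near i)
      = ENNReal.ofReal ((4 * scale i - scale i / 2) * (5 * scale i) ^ n) * unitVol n := by
        rw [near, volume_box _ _ _ (by positivity), ENNReal.ofReal_mul h2, mul_assoc]
    _ ≤ ENNReal.ofReal (4 * 5 ^ n * n ^ n * (scale i ^ (n + 1) * ((n : ℝ)⁻¹) ^ n)) *
          unitVol n := by gcongr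
    _ = _ := by
        rw [ENNReal.ofReal_mul (by positivity), volume_cube, nearConst]
        ring

lemma essSup_whitney_le_tsum (hn : 1 ≤ n) (H : Pt n → ℝ≥0∞) (q : Pt n) :
    essSup H (volume.restrict (whitney q)) ≤ ∑' i : CubeIdx n,
      (near i).indicator (fun _ => essSup H (volume.restrict (cube i))) q := by
  refine essSup_le_of_ae_le _ ?_
  have h1 : ∀ᵐ p : Pt n, ∀ i : CubeIdx n, p ∈ cube i →
      H p ≤ essSup H (volume.restrict (cube i)) :=
    ae_all_iff.2 fun i => (ae_restrict_iff' (measurableSet_cube i)).1 (ENNReal.ae_le_essSup H)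
  filter_upwards [ae_restrict_of_ae h1, ae_restrict_mem (measurableSet_whitney q)] with p hp hpq
  obtain ⟨i, hi⟩ := exists_mem_cube hn (pos_of_mem_whitney' hpq)
  refine (hp i hi).trans ?_
  refine le_trans (le_of_eq ?_) (ENNReal.le_tsum i)
  rw [indicator_of_mem (mem_near hn hi hpq)]

/-- The Whitney supremum at `q` is at most the sum of the cell suprema over cells near `q`.
Integrating charges each cell the volume of `near i`, comparable to its own, and for `q` in the tent
only cells inside the enlarged tent occur. -/
lemma lintegral_tent_essSup_le (hn : 1 ≤ n) {H : Pt n → ℝ≥0∞}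
    {x : EuclideanSpace ℝ (Fin n)} {r : ℝ} {B : ℝ≥0∞}
    (hB : ∀ J : Finset (CubeIdx n), (∀ i ∈ J, cube i ⊆ tent x (17 * r)) →
      ∑ i ∈ J, essSup H (volume.restrict (cube i)) * volume (cube i) ≤ B) :
    ∫⁻ q in tent x r, essSup H (volume.restrict (whitney q)) ≤ nearConst n * B := by
  classical
  set S : Set (CubeIdx n) := {i | cube i ⊆ tent x (17 * r)}
  set h : CubeIdx n → ℝ≥0∞ := fun i => essSup H (volume.restrict (cube i))
  have hnear : ∀ i : CubeIdx n, MeasurableSet (near i) := fun i =>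
    measurableSet_Ioo.prod measurableSet_ball
  calc ∫⁻ q in tent x r, essSup H (volume.restrict (whitney q))
      ≤ ∫⁻ q in tent x r, ∑' i : CubeIdx n, (near i).indicator (fun _ => S.indicator h i) q := by
        refine setLIntegral_mono' (measurableSet_tent x r) fun q hq => ?_
        refine (essSup_whitney_le_tsum hn H q).trans (ENNReal.tsum_le_tsum fun i => ?_)
        by_cases hqi : q ∈ near i
        · rw [indicator_of_mem hqi, indicator_of_mem hqi,
            indicator_of_mem (show i ∈ S from cube_subset_tent_of_near hn hqi hq)]
        · rw [indicator_of_notMem hqi]; exact bot_le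
    _ ≤ ∫⁻ q, ∑' i : CubeIdx n, (near i).indicator (fun _ => S.indicator h i) q :=
        lintegral_mono' Measure.restrict_le_self le_rfl
    _ = ∑' i : CubeIdx n, S.indicator h i * volume (near i) := by
        rw [lintegral_tsum fun i => (measurable_const.indicator (hnear i)).aemeasurable]
        exact tsum_congr fun i => lintegral_indicator_const (hnear i) _
    _ ≤ ∑' i : CubeIdx n, nearConst n * S.indicator (fun i => h i * volume (cube i)) i := by
        refine ENNReal.tsum_le_tsum fun i => ?_
        by_cases hi : i ∈ S
        · rw [indicator_of_mem hi, indicator_of_mem hi, mul_left_comm]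
          gcongr
          exact volume_near_le hn i
        · rw [indicator_of_notMem hi, zero_mul]; exact bot_le
    _ = nearConst n * ∑' i : CubeIdx n, S.indicator (fun i => h i * volume (cube i)) i :=
        ENNReal.tsum_mul_left
    _ ≤ nearConst n * B := by
        gcongr
        rw [ENNReal.tsum_eq_iSup_sum]
        refine iSup_le fun J => ?_
        have : ∑ i ∈ J, S.indicator (fun i => h i * volume (cube i)) i =
            ∑ i ∈ J with i ∈ S, h i * volume (cube i) := by
          rw [Finset.sum_filter]; rfl
        rw [this]
        exact hB _ fun i hi => (Finset.mem_filter.1 hi).2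

/-- It suffices to bound sums of finite levels, each attained on a non-null part of its cell. -/
lemma sum_essSup_le (hn : 1 ≤ n) {H : Pt n → ℝ≥0∞} (hH : Measurable H)
    (J : Finset (CubeIdx n)) {B : ℝ≥0∞}
    (hB : ∀ lam : CubeIdx n → ℝ≥0,
      (∀ i ∈ J, volume (cube i ∩ {p | (lam i : ℝ≥0∞) ≤ H p}) ≠ 0) →
      ∑ i ∈ J, lam i * volume (cube i) ≤ B) :
    ∑ i ∈ J, essSup H (volume.restrict (cube i)) * volume (cube i) ≤ 2 * B := by
  set h : CubeIdx n → ℝ≥0∞ := fun i => essSup H (volume.restrict (cube i))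
  have hbd : ∀ M : ℕ, ∑ i ∈ J, min (h i) M * volume (cube i) ≤ 2 * B := by
    intro M
    -- The cap `M` keeps the levels finite, and halving puts a nonzero level strictly below the
    -- essential supremum, so that it is exceeded on a non-null set. A zero level is attained on the
    -- whole cell.
    set lam : CubeIdx n → ℝ≥0 := fun i => (min (h i) M).toNNReal / 2
    have hlam : ∀ i, (lam i : ℝ≥0∞) = min (h i) M / 2 := by
      intro i
      have : min (h i) (M : ℝ≥0∞) ≠ ⊤ := (min_lt_of_right_lt (by simp)).ne
      simp only [lam]
      rw [ENNReal.coe_div two_ne_zero, ENNReal.coe_toNNReal this, ENNReal.coe_ofNat]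
    have := hB lam fun i _ => by
      rcases eq_or_ne (min (h i) (M : ℝ≥0∞)) 0 with h0 | h0
      · simp only [hlam, h0, ENNReal.zero_div, zero_le, ofPred_true, inter_univ]
        exact volume_cube_ne_zero hn i
      · have hlt : (lam i : ℝ≥0∞) < h i := by
          rw [hlam]
          exact (ENNReal.half_lt_self h0 (min_lt_of_right_lt (by simp)).ne).trans_le
            (min_le_left _ _)
        have h1 := lt_essSup_iff.1 hlt
        rw [Measure.restrict_apply (measurableSet_lt measurable_const hH), inter_comm] at h1
        exact fun h2 => h1 (measure_mono_null
          (inter_subset_inter_right _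
            (show {p | (lam i : ℝ≥0∞) < H p} ⊆ {p | (lam i : ℝ≥0∞) ≤ H p} by
              intro p hp
              rw [mem_ofPred_eq] at hp ⊢
              exact hp.le)) h2)
    calc ∑ i ∈ J, min (h i) M * volume (cube i) = 2 * ∑ i ∈ J, lam i * volume (cube i) := by
          rw [Finset.mul_sum]
          refine Finset.sum_congr rfl fun i _ => ?_
          rw [hlam, ← mul_assoc, ENNReal.mul_div_cancel two_ne_zero (by simp)]
      _ ≤ _ := by gcongr
  have hsup : ∀ i, h i * volume (cube i) = ⨆ M : ℕ, min (h i) M * volume (cube i) := by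
    intro i
    rw [← ENNReal.iSup_mul]
    congr 1
    refine le_antisymm ?_ (iSup_le fun M => min_le_left _ _)
    have h1 : Tendsto (fun M : ℕ => min (h i) (M : ℝ≥0∞)) atTop (nhds (min (h i) ⊤)) :=
      tendsto_const_nhds.min ENNReal.tendsto_nat_nhds_top
    rw [min_top_right] at h1
    exact le_of_tendsto' h1 fun M => le_iSup (fun M : ℕ => min (h i) (M : ℝ≥0∞)) M
  rw [Finset.sum_congr rfl fun i _ => hsup i, ENNReal.finsetSum_iSup_of_monotone]
  · exact iSup_le hbd
  · intro i M M' hM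
    simp only
    gcongr

/-! ### Test functions concentrated on parts of grid cells -/

/-- The function with value `a i • v` on `F i`, for `i ∈ J`. -/
def testFun (J : Finset (CubeIdx n)) (F : CubeIdx n → Set (Pt n)) (a : CubeIdx n → ℝ≥0)
    (v : Val n m) (p : Pt n) : Val n m :=
  ∑ i ∈ J, (F i).indicator (fun _ => ((a i : ℝ) : ℂ) • v) p

section
variable {J : Finset (CubeIdx n)} {F : CubeIdx n → Set (Pt n)} {a : CubeIdx n → ℝ≥0}
  {v : Val n m}

lemma stronglyMeasurable_testFun (hF : ∀ i, MeasurableSet (F i)) :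
    StronglyMeasurable (testFun J F a v) :=
  Finset.stronglyMeasurable_fun_sum J fun i _ => stronglyMeasurable_const.indicator (hF i)

lemma testFun_of_mem (hn : 1 ≤ n) (hFQ : ∀ i, F i ⊆ cube i) {i : CubeIdx n} (hi : i ∈ J)
    {p : Pt n} (hp : p ∈ F i) : testFun J F a v p = ((a i : ℝ) : ℂ) • v := by
  rw [testFun, Finset.sum_eq_single_of_mem i hi, indicator_of_mem hp]
  intro j _ hji
  exact indicator_of_notMem (fun hpj =>
    Set.disjoint_left.1 (cube_disjoint hn hji) (hFQ j hpj) (hFQ i hp)) _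

lemma testFun_of_notMem {p : Pt n} (hp : ∀ i ∈ J, p ∉ F i) : testFun J F a v p = 0 :=
  Finset.sum_eq_zero fun i hi => indicator_of_notMem (hp i hi) _

/-- The sets `F i` are disjoint, so at most one summand is nonzero and any `κ`, linear or not,
passes through the sum once it vanishes at `0`. -/
lemma apply_testFun (hn : 1 ≤ n) (hFQ : ∀ i, F i ⊆ cube i) (κ : Pt n → Val n m → ℝ≥0∞)
    (hκ : ∀ p, κ p 0 = 0) (p : Pt n) :
    κ p (testFun J F a v p) =
      ∑ i ∈ J, (F i).indicator (fun p => κ p (((a i : ℝ) : ℂ) • v)) p := by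
  by_cases h : ∃ i ∈ J, p ∈ F i
  · obtain ⟨i, hi, hp⟩ := h
    rw [testFun_of_mem hn hFQ hi hp, Finset.sum_eq_single_of_mem i hi, indicator_of_mem hp]
    intro j _ hji
    exact indicator_of_notMem (fun hpj =>
      Set.disjoint_left.1 (cube_disjoint hn hji) (hFQ j hpj) (hFQ i hp)) _
  · push Not at h
    rw [testFun_of_notMem h, hκ]
    exact (Finset.sum_eq_zero fun i hi => indicator_of_notMem (h i hi) _).symm

lemma lintegral_testFun (hn : 1 ≤ n) (hF : ∀ i, MeasurableSet (F i)) (hFQ : ∀ i, F i ⊆ cube i)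
    (μ : Measure (Pt n)) (κ : Pt n → Val n m → ℝ≥0∞) (hκ : ∀ p, κ p 0 = 0)
    (hκm : ∀ w, Measurable fun p => κ p w) :
    ∫⁻ p, κ p (testFun J F a v p) ∂μ = ∑ i ∈ J, ∫⁻ p in F i, κ p (((a i : ℝ) : ℂ) • v) ∂μ := by
  simp_rw [apply_testFun hn hFQ κ hκ]
  rw [lintegral_finsetSum _ fun i _ => (hκm _).indicator (hF i)]
  exact Finset.sum_congr rfl fun i _ => lintegral_indicator (hF i) _

end

lemma enorm_real_smul (a : ℝ≥0) (v : Val n m) : ‖((a : ℝ) : ℂ) • v‖ₑ = a * ‖v‖ₑ := by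
  rw [enorm_smul]
  congr 1
  rw [← ofReal_norm, Complex.norm_real, Real.norm_of_nonneg (NNReal.coe_nonneg a)]
  simp

/-- The density `|E v|²/t`. -/
def densV (E : Pt n → (Val n m →L[ℂ] Val n m)) (v : Val n m) (p : Pt n) : ℝ≥0∞ :=
  ‖‖E p v‖ ^ 2 / p.1‖ₑ

lemma stronglyMeasurable_apply {E : Pt n → (Val n m →L[ℂ] Val n m)} (hE : StronglyMeasurable E)
    (v : Val n m) : StronglyMeasurable fun p => E p v :=
  stronglyMeasurable_mult hE (f := fun _ => v) stronglyMeasurable_const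

lemma measurable_densV {E : Pt n → (Val n m →L[ℂ] Val n m)} (hE : StronglyMeasurable E)
    (v : Val n m) : Measurable (densV E v) := by
  have h : Measurable fun p => ‖E p v‖ := (stronglyMeasurable_apply hE v).norm.measurable
  unfold densV
  fun_prop

lemma densV_mul (E : Pt n → (Val n m →L[ℂ] Val n m)) (v : Val n m) {p : Pt n} (hp : 0 < p.1) :
    densV E v p * ENNReal.ofReal p.1 = ‖E p v‖ₑ ^ 2 := by
  have h0 : 0 ≤ ‖E p v‖ ^ 2 / p.1 := by positivity
  rw [densV, Real.enorm_of_nonneg h0, ← ENNReal.ofReal_mul h0, div_mul_cancel₀ _ hp.ne',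
    ENNReal.ofReal_pow (norm_nonneg _), ofReal_norm]

lemma enorm_apply_smul_sq (E : Pt n → (Val n m →L[ℂ] Val n m)) (v : Val n m) (a : ℝ≥0)
    {p : Pt n} (hp : 0 < p.1) :
    ‖E p (((a : ℝ) : ℂ) • v)‖ₑ ^ 2 = (a : ℝ≥0∞) ^ 2 * (densV E v p * ENNReal.ofReal p.1) := by
  rw [densV_mul _ _ hp, map_smul, enorm_real_smul, mul_pow]

lemma restrict_halfVol {s : Set (Pt n)} (hs : MeasurableSet s) (hsub : s ⊆ halfSpace n) :
    (halfVol n).restrict s = volume.restrict s := by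
  rw [halfVol, Measure.restrict_restrict hs, inter_eq_self_of_subset_left hsub]

section
variable {J : Finset (CubeIdx n)} {F : CubeIdx n → Set (Pt n)} {a β lam : CubeIdx n → ℝ≥0}
  {v : Val n m} {E : Pt n → (Val n m →L[ℂ] Val n m)}

lemma le_normL2_mult_testFun (hn : 1 ≤ n) (hE : StronglyMeasurable E)
    (hF : ∀ i, MeasurableSet (F i)) (hFQ : ∀ i, F i ⊆ cube i)
    (hlam : ∀ i ∈ J, ∀ p ∈ F i, (lam i : ℝ≥0∞) ≤ densV E v p)
    (ha : ∀ i ∈ J, (a i : ℝ≥0∞) ^ 2 * volume (F i) = β i * volume (cube i)) :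
    ∑ i ∈ J, lam i * (β i * volume (cube i)) ≤ normL2 (-1) (mult E (testFun J F a v)) ^ 2 := by
  rw [normL2_sq]
  have h := lintegral_testFun (J := J) (a := a) (v := v) hn hF hFQ (halfVol n)
    (fun p w => ‖E p w‖ₑ ^ 2 * ENNReal.ofReal (p.1 ^ (-1 : ℝ))) (fun p => by simp)
    (fun w => ((stronglyMeasurable_apply hE w).enorm.pow_const 2).mul (by fun_prop))
  change _ ≤ ∫⁻ p, ‖E p (testFun J F a v p)‖ₑ ^ 2 * ENNReal.ofReal (p.1 ^ (-1 : ℝ)) ∂(halfVol n)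
  rw [h]
  refine Finset.sum_le_sum fun i hi => ?_
  rw [restrict_halfVol (hF i) ((hFQ i).trans (cube_subset_halfSpace i)), ← ha i hi,
    ← mul_assoc, ← setLIntegral_const]
  refine setLIntegral_mono' (hF i) fun p hp => ?_
  have hp0 : 0 < p.1 := cube_subset_halfSpace i (hFQ i hp)
  rw [enorm_apply_smul_sq _ _ _ hp0, mul_assoc, mul_assoc, ← ENNReal.ofReal_mul hp0.le,
    Real.rpow_neg_one, mul_inv_cancel₀ hp0.ne', ENNReal.ofReal_one, mul_one, mul_comm]
  gcongr
  exact hlam i hi p hp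

lemma normL2_testFun_le (hn : 1 ≤ n) (hv : ‖v‖ₑ = 1)
    (hF : ∀ i, MeasurableSet (F i)) (hFQ : ∀ i, F i ⊆ cube i)
    (ha : ∀ i ∈ J, (a i : ℝ≥0∞) ^ 2 * volume (F i) = β i * volume (cube i)) :
    normL2 1 (testFun J F a v) ^ 2 ≤
      ∑ i ∈ J, 2 * (ENNReal.ofReal (scale i) * (β i * volume (cube i))) := by
  rw [normL2_sq, lintegral_testFun (J := J) (a := a) (v := v) hn hF hFQ (halfVol n)
    (fun p w => ‖w‖ₑ ^ 2 * ENNReal.ofReal (p.1 ^ (1 : ℝ))) (fun p => by simp)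
    (fun w => by fun_prop)]
  refine Finset.sum_le_sum fun i hi => ?_
  rw [restrict_halfVol (hF i) ((hFQ i).trans (cube_subset_halfSpace i)), ← ha i hi,
    ← mul_assoc, ← mul_assoc, ← setLIntegral_const]
  refine setLIntegral_mono' (hF i) fun p hp => ?_
  have hp1 : p.1 ≤ 2 * scale i := (hFQ i hp).1.2.le
  rw [enorm_real_smul, hv, mul_one, Real.rpow_one, mul_comm]
  gcongr
  rw [← ENNReal.ofReal_ofNat 2, ← ENNReal.ofReal_mul zero_le_two]
  exact ENNReal.ofReal_le_ofReal hp1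

/-- The bound of `W_2` of a normalised test function. -/
def starConst (n : ℕ) : ℝ≥0∞ := ENNReal.ofReal (4 * 3 ^ n) * unitVol n

lemma starConst_ne_top (n : ℕ) : starConst n ≠ ⊤ :=
  ENNReal.mul_ne_top ENNReal.ofReal_ne_top (unitVol_ne_top n)

/-- Each cell carries mass equal to its volume, and the cells meeting the Whitney region of `q` are
disjoint and lie in a box of size comparable to `q.1`. -/
lemma whitneyTwo_testFun_sq_le (hn : 1 ≤ n) (hv : ‖v‖ₑ = 1)
    (hF : ∀ i, MeasurableSet (F i)) (hFQ : ∀ i, F i ⊆ cube i)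
    (ha : ∀ i ∈ J, (a i : ℝ≥0∞) ^ 2 * volume (F i) = volume (cube i)) (q : Pt n) :
    whitneyTwo (testFun J F a v) q ^ 2 ≤ starConst n := by
  classical
  rcases le_or_gt q.1 0 with hq | hq
  · rw [whitneyTwo_sq, whitneyAvg_of_nonpos _ hq]; exact bot_le
  set J' := {i ∈ J | (cube i ∩ whitney q).Nonempty}
  have hsub : (⋃ i ∈ J', cube i) ⊆ Ioo 0 (4 * q.1) ×ˢ ball q.2 (3 * q.1) := by
    refine iUnion₂_subset fun i hi p hp => ?_
    obtain ⟨p', hp', hp'q⟩ := (Finset.mem_filter.1 hi).2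
    obtain ⟨h1, h2, h3⟩ := mem_whitney_iff.1 hp'q
    have h4 := norm_sub_lt_scale hn hp hp'
    have h5 := norm_sub_le_norm_sub_add_norm_sub p.2 p'.2 q.2
    obtain ⟨h6, h7⟩ := hp.1
    obtain ⟨h8, h9⟩ := hp'.1
    rw [mem_prod, mem_Ioo, mem_ball, dist_eq_norm]
    exact ⟨⟨cube_subset_halfSpace i hp, by linarith⟩, by linarith⟩
  have hint : ∫⁻ p in whitney q, ‖testFun J F a v p‖ₑ ^ 2 ≤
      volume (Ioo 0 (4 * q.1) ×ˢ ball q.2 (3 * q.1)) := by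
    calc ∫⁻ p in whitney q, ‖testFun J F a v p‖ₑ ^ 2
        = ∑ i ∈ J, ∫⁻ p in F i, ‖((a i : ℝ) : ℂ) • v‖ₑ ^ 2 ∂(volume.restrict (whitney q)) :=
          lintegral_testFun hn hF hFQ _ (fun _ w => ‖w‖ₑ ^ 2) (fun _ => by simp)
            (fun _ => measurable_const)
      _ = ∑ i ∈ J, (a i : ℝ≥0∞) ^ 2 * volume (F i ∩ whitney q) := by
          refine Finset.sum_congr rfl fun i _ => ?_
          rw [Measure.restrict_restrict (hF i), setLIntegral_const, enorm_real_smul, hv, mul_one]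
      _ ≤ ∑ i ∈ J, if (cube i ∩ whitney q).Nonempty then volume (cube i) else 0 := by
          refine Finset.sum_le_sum fun i hi => ?_
          split_ifs with h
          · rw [← ha i hi]
            gcongr
            exact inter_subset_left
          · rw [not_nonempty_iff_eq_empty] at h
            rw [subset_empty_iff.1 ((inter_subset_inter_left _ (hFQ i)).trans h.subset)]
            simp
      _ = ∑ i ∈ J', volume (cube i) := (Finset.sum_filter _ _).symm
      _ = volume (⋃ i ∈ J', cube i) :=
          (measure_biUnion_finset (fun i _ j _ hij => cube_disjoint hn hij)
            fun i _ => measurableSet_cube i).symm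
      _ ≤ _ := measure_mono hsub
  rw [whitneyTwo_sq, whitneyAvg]
  calc _ ≤ (ENNReal.ofReal (q.1 ^ (n + 1)))⁻¹ *
        volume (Ioo 0 (4 * q.1) ×ˢ ball q.2 (3 * q.1)) := by gcongr
    _ = starConst n := by
        rw [volume_box _ _ _ (by positivity), sub_zero, ← mul_assoc, ← mul_assoc,
          ← ENNReal.ofReal_inv_of_pos (by positivity), ← ENNReal.ofReal_mul (by positivity),
          ← ENNReal.ofReal_mul (by positivity), starConst]
        congr 2
        field_simp
        ring

lemma whitneyTwo_testFun_eq_zero (hFQ : ∀ i, F i ⊆ cube i) {q : Pt n}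
    (hq : ∀ i ∈ J, cube i ∩ whitney q = ∅) : whitneyTwo (testFun J F a v) q = 0 := by
  have h : whitneyTwo (testFun J F a v) q ^ 2 = 0 := by
    rw [whitneyTwo_sq, whitneyAvg, setLIntegral_congr_fun (measurableSet_whitney q)
      (g := fun _ => 0)]
    · simp
    · intro p hp
      have : testFun J F a v p = 0 := testFun_of_notMem fun i hi hpi => by
        have : p ∈ cube i ∩ whitney q := ⟨hFQ i hpi, hp⟩
        rw [hq i hi] at this
        exact this
      simp [this]
  exact eq_zero_of_pow_eq_zero h

/-- If the cone over `z` contains a `q` whose Whitney region meets a cell at `p`, then `z` is within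
`2 * q.1 < 4 * p.1` of `p.2`; hence `z` lies in the ball of radius `5 · 17 r`. -/
lemma nonTangMax_testFun_sq_le (hn : 1 ≤ n) (hv : ‖v‖ₑ = 1)
    (hF : ∀ i, MeasurableSet (F i)) (hFQ : ∀ i, F i ⊆ cube i)
    (ha : ∀ i ∈ J, (a i : ℝ≥0∞) ^ 2 * volume (F i) = volume (cube i))
    {x : EuclideanSpace ℝ (Fin n)} {r : ℝ} (hJ : ∀ i ∈ J, cube i ⊆ tent x (17 * r))
    (z : EuclideanSpace ℝ (Fin n)) :
    nonTangMax (whitneyTwo (testFun J F a v)) z ^ 2 ≤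
      (ball x (85 * r)).indicator (fun _ => starConst n) z := by
  by_cases hz : z ∈ ball x (85 * r)
  · rw [indicator_of_mem hz]
    have : nonTangMax (whitneyTwo (testFun J F a v)) z ≤ starConst n ^ (1 / 2 : ℝ) := by
      refine iSup₂_le fun q _ => ?_
      rw [← ENNReal.pow_le_pow_left_iff two_ne_zero, rpow_half_sq]
      exact whitneyTwo_testFun_sq_le hn hv hF hFQ ha q
    calc _ ≤ (starConst n ^ (1 / 2 : ℝ)) ^ 2 := pow_le_pow_left' this 2
      _ = _ := rpow_half_sq _
  · rw [indicator_of_notMem hz]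
    have : nonTangMax (whitneyTwo (testFun J F a v)) z = 0 := by
      refine le_antisymm (iSup₂_le fun q hqz => le_of_eq ?_) bot_le
      refine whitneyTwo_testFun_eq_zero hFQ fun i hi => ?_
      by_contra hne
      obtain ⟨p, hp, hpq⟩ := nonempty_iff_ne_empty.2 hne
      apply hz
      obtain ⟨h1, h2⟩ := hJ i hi hp
      obtain ⟨h3, h4, h5⟩ := mem_whitney_iff.1 hpq
      rw [norm_sub_rev] at hqz h5
      have h6 := norm_sub_le_norm_sub_add_norm_sub z q.2 x
      have h7 := norm_sub_le_norm_sub_add_norm_sub q.2 p.2 x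
      have h8 := norm_nonneg (p.2 - x)
      rw [mem_ball, dist_eq_norm]
      linarith
    rw [this]
    simp

lemma normN_testFun_sq_le (hn : 1 ≤ n) (hv : ‖v‖ₑ = 1)
    (hF : ∀ i, MeasurableSet (F i)) (hFQ : ∀ i, F i ⊆ cube i)
    (ha : ∀ i ∈ J, (a i : ℝ≥0∞) ^ 2 * volume (F i) = volume (cube i))
    {x : EuclideanSpace ℝ (Fin n)} {r : ℝ} (hr : 0 < r)
    (hJ : ∀ i ∈ J, cube i ⊆ tent x (17 * r)) :
    normN (testFun J F a v) ^ 2 ≤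
      starConst n * (ENNReal.ofReal (85 ^ n) * unitVol n) * ENNReal.ofReal (r ^ n) := by
  rw [normN_sq]
  calc _ ≤ ∫⁻ z, (ball x (85 * r)).indicator (fun _ => starConst n) z :=
        lintegral_mono (nonTangMax_testFun_sq_le hn hv hF hFQ ha hJ)
    _ = starConst n * volume (ball x (85 * r)) := lintegral_indicator_const measurableSet_ball _
    _ = _ := by
        rw [volume_ball_eq _ (by positivity), mul_pow, ENNReal.ofReal_mul (by positivity)]
        ring

/-- The lower bound of `W_2` on the cells, relative to the level. -/
def cellConst (n : ℕ) : ℝ≥0∞ := ENNReal.ofReal ((2 ^ (n + 1))⁻¹ * ((n : ℝ)⁻¹) ^ n)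

lemma cellConst_le_one (hn : 1 ≤ n) : cellConst n ≤ 1 := by
  have hn' : (1 : ℝ) ≤ n := by exact_mod_cast hn
  rw [cellConst, ← ENNReal.ofReal_one]
  apply ENNReal.ofReal_le_ofReal
  exact mul_le_one₀ (inv_le_one_of_one_le₀ (one_le_pow₀ one_le_two)) (by positivity)
    (pow_le_one₀ (by positivity) (inv_le_one_of_one_le₀ hn'))

lemma cellConst_ne_zero (hn : 1 ≤ n) : cellConst n ≠ 0 := by
  have hn' : (0 : ℝ) < n := by exact_mod_cast hn
  have : 0 < (2 ^ (n + 1))⁻¹ * ((n : ℝ)⁻¹) ^ n := by positivity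
  simpa [cellConst] using this

/-- With `β i` equal to level over scale, the image has squared mass at least `lam i ^ 2` times the
cell volume, and the whole cell lies in the Whitney region of each of its points. -/
lemma le_whitneyTwo_mult_testFun (hn : 1 ≤ n)
    (hF : ∀ i, MeasurableSet (F i)) (hFQ : ∀ i, F i ⊆ cube i)
    (hlam : ∀ i ∈ J, ∀ p ∈ F i, (lam i : ℝ≥0∞) ≤ densV E v p)
    (ha : ∀ i ∈ J, (a i : ℝ≥0∞) ^ 2 * volume (F i) = β i * volume (cube i))
    (hβ : ∀ i ∈ J, ENNReal.ofReal (scale i) * β i = lam i) {i : CubeIdx n} (hi : i ∈ J)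
    {q : Pt n} (hq : q ∈ cube i) :
    cellConst n * lam i ≤ whitneyTwo (mult E (testFun J F a v)) q := by
  have hs := scale_pos i
  have hn' : (0 : ℝ) < n := by exact_mod_cast hn
  have hq0 : 0 < q.1 := cube_subset_halfSpace i hq
  have hint : (lam i : ℝ≥0∞) ^ 2 * volume (cube i) ≤
      ∫⁻ p in whitney q, ‖mult E (testFun J F a v) p‖ₑ ^ 2 := by
    calc (lam i : ℝ≥0∞) ^ 2 * volume (cube i)
        = ((a i : ℝ≥0∞) ^ 2 * (lam i * ENNReal.ofReal (scale i))) * volume (F i) := by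
          calc _ = lam i * (ENNReal.ofReal (scale i) * β i) * volume (cube i) := by
                rw [hβ i hi, sq]
            _ = lam i * ENNReal.ofReal (scale i) * (β i * volume (cube i)) := by ring
            _ = _ := by rw [← ha i hi]; ring
      _ = ∫⁻ _ in F i, (a i : ℝ≥0∞) ^ 2 * (lam i * ENNReal.ofReal (scale i)) :=
          (setLIntegral_const _ _).symm
      _ ≤ ∫⁻ p in F i, ‖mult E (testFun J F a v) p‖ₑ ^ 2 := by
          refine setLIntegral_mono' (hF i) fun p hp => ?_
          rw [mult, testFun_of_mem hn hFQ hi hp,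
            enorm_apply_smul_sq _ _ _ (cube_subset_halfSpace i (hFQ i hp))]
          gcongr
          · exact hlam i hi p hp
          · exact (hFQ i hp).1.1
      _ ≤ _ := lintegral_mono_set ((hFQ i).trans (cube_subset_whitney hn hq))
  -- The natural constant is the square root of `cellConst n`; as `cellConst n ≤ 1`, using it
  -- unrooted only weakens the bound.
  have hsq : (cellConst n * lam i) ^ 2 ≤ whitneyTwo (mult E (testFun J F a v)) q ^ 2 := by
    calc (cellConst n * lam i) ^ 2 = cellConst n ^ 2 * (lam i : ℝ≥0∞) ^ 2 := mul_pow _ _ _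
      _ ≤ cellConst n * (lam i : ℝ≥0∞) ^ 2 := by
          gcongr
          rw [sq]
          exact mul_le_of_le_one_left' (cellConst_le_one hn)
      _ ≤ (ENNReal.ofReal (q.1 ^ (n + 1)))⁻¹ * volume (cube i) * (lam i : ℝ≥0∞) ^ 2 := by
          gcongr
          rw [volume_cube, cellConst, ← ENNReal.ofReal_inv_of_pos (by positivity),
            ← ENNReal.ofReal_mul (by positivity)]
          apply ENNReal.ofReal_le_ofReal
          have h1 : q.1 ^ (n + 1) ≤ (2 * scale i) ^ (n + 1) := by
            gcongr; exact hq.1.2.le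
          calc (2 ^ (n + 1))⁻¹ * ((n : ℝ)⁻¹) ^ n
              = ((2 * scale i) ^ (n + 1))⁻¹ * (scale i ^ (n + 1) * ((n : ℝ)⁻¹) ^ n) := by
                rw [mul_pow]; field_simp
            _ ≤ _ := by gcongr
      _ ≤ (ENNReal.ofReal (q.1 ^ (n + 1)))⁻¹ *
            ∫⁻ p in whitney q, ‖mult E (testFun J F a v) p‖ₑ ^ 2 := by
          rw [mul_assoc, mul_comm (volume (cube i))]
          gcongr
      _ = _ := by rw [whitneyTwo_sq, whitneyAvg]
  exact (ENNReal.pow_le_pow_left_iff two_ne_zero).1 hsq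

/-- For every centre in `B(x, r)` the tent of radius `18 r = r + 17 r` contains all the cells, so
the Carleson functional is bounded below by one constant on the whole ball. -/
lemma le_normC_mult_testFun (hn : 1 ≤ n)
    (hF : ∀ i, MeasurableSet (F i)) (hFQ : ∀ i, F i ⊆ cube i)
    (hlam : ∀ i ∈ J, ∀ p ∈ F i, (lam i : ℝ≥0∞) ≤ densV E v p)
    (ha : ∀ i ∈ J, (a i : ℝ≥0∞) ^ 2 * volume (F i) = β i * volume (cube i))
    (hβ : ∀ i ∈ J, ENNReal.ofReal (scale i) * β i = lam i)
    {x : EuclideanSpace ℝ (Fin n)} {r : ℝ} (hr : 0 < r)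
    (hJ : ∀ i ∈ J, cube i ⊆ tent x (17 * r)) :
    ((ENNReal.ofReal ((18 * r) ^ n))⁻¹ * (cellConst n * ∑ i ∈ J, lam i * volume (cube i))) ^ 2 *
      (ENNReal.ofReal (r ^ n) * unitVol n) ≤ normC (mult E (testFun J F a v)) ^ 2 := by
  rw [normC_sq, ← volume_ball_eq x hr, ← setLIntegral_const]
  refine le_trans ?_ (lintegral_mono' (Measure.restrict_le_self (s := ball x r)) le_rfl)
  refine setLIntegral_mono' measurableSet_ball fun z hz => ?_
  refine pow_le_pow_left' ?_ 2
  rw [mem_ball, dist_comm, dist_eq_norm] at hz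
  rw [carlesonFun_eq]
  refine le_trans ?_ (le_iSup₂ (18 * r) (by positivity))
  gcongr 1
  have hsub : (⋃ i ∈ J, cube i) ⊆ tent z (18 * r) :=
    iUnion₂_subset fun i hi => (hJ i hi).trans (tent_subset_tent (by linarith))
  refine le_trans ?_ (lintegral_mono_set hsub)
  rw [lintegral_biUnion_finset (fun i _ j _ hij => cube_disjoint hn hij)
    (fun i _ => measurableSet_cube i), Finset.mul_sum]
  refine Finset.sum_le_sum fun i hi => ?_
  rw [← mul_assoc, ← setLIntegral_const]
  exact setLIntegral_mono' (measurableSet_cube i) fun q hq =>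
    le_whitneyTwo_mult_testFun hn hF hFQ hlam ha hβ hi hq

end

/-! ### Testing inequalities for sums over cells -/

lemma exists_amplitude {u c : ℝ≥0∞} (hu : u ≠ 0) (hu' : u ≠ ⊤) (hc : c ≠ ⊤) :
    ∃ a : ℝ≥0, (a : ℝ≥0∞) ^ 2 * u = c := by
  have h : (c / u) ^ (1 / 2 : ℝ) ≠ ⊤ :=
    ENNReal.rpow_ne_top_of_nonneg (by norm_num) (ENNReal.div_ne_top hc hu)
  refine ⟨((c / u) ^ (1 / 2 : ℝ)).toNNReal, ?_⟩
  rw [ENNReal.coe_toNNReal h, rpow_half_sq, ENNReal.div_mul_cancel hu hu']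

lemma exists_amplitudes {J : Finset (CubeIdx n)} {F : CubeIdx n → Set (Pt n)}
    (hFQ : ∀ i, F i ⊆ cube i) (hF0 : ∀ i ∈ J, volume (F i) ≠ 0) (β : CubeIdx n → ℝ≥0) :
    ∃ a : CubeIdx n → ℝ≥0, ∀ i ∈ J, (a i : ℝ≥0∞) ^ 2 * volume (F i) = β i * volume (cube i) := by
  classical
  have h : ∀ i, ∃ a : ℝ≥0, i ∈ J → (a : ℝ≥0∞) ^ 2 * volume (F i) = β i * volume (cube i) := by
    intro i
    by_cases hi : i ∈ J
    · obtain ⟨a, ha⟩ := exists_amplitude (hF0 i hi)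
        ((measure_mono (hFQ i)).trans_lt (volume_cube_ne_top i).lt_top).ne
        (ENNReal.mul_ne_top ENNReal.coe_ne_top (volume_cube_ne_top i) :
          (β i : ℝ≥0∞) * volume (cube i) ≠ ⊤)
      exact ⟨a, fun _ => ha⟩
    · exact ⟨0, fun h => absurd h hi⟩
  choose a ha using h
  exact ⟨a, ha⟩

/-- The constant of the lower bound by testing on `N_{2,2}`. -/
def testNConst (n : ℕ) : ℝ≥0∞ := starConst n * (ENNReal.ofReal (85 ^ n) * unitVol n)

lemma testNConst_ne_top (n : ℕ) : testNConst n ≠ ⊤ :=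
  ENNReal.mul_ne_top (starConst_ne_top n)
    (ENNReal.mul_ne_top ENNReal.ofReal_ne_top (unitVol_ne_top n))

/-- Unit mass density on every cell (`β = 1`): the norm of the test function sees only the size of
the tent, and the image recovers the sum of the levels. -/
lemma sum_le_of_bounded_N (hn : 1 ≤ n) {E : Pt n → (Val n m →L[ℂ] Val n m)}
    (hE : StronglyMeasurable E) {v : Val n m} (hv : ‖v‖ₑ = 1) {B : ℝ≥0∞}
    (hB : ∀ f : Pt n → Val n m, StronglyMeasurable f → normN f ≠ ⊤ →
      normL2 (-1) (mult E f) ^ 2 ≤ B * normN f ^ 2)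
    {x : EuclideanSpace ℝ (Fin n)} {r : ℝ} (hr : 0 < r) {J : Finset (CubeIdx n)}
    (hJ : ∀ i ∈ J, cube i ⊆ tent x (17 * r)) {lam : CubeIdx n → ℝ≥0}
    (hlam : ∀ i ∈ J, volume (cube i ∩ {p | (lam i : ℝ≥0∞) ≤ densV E v p}) ≠ 0) :
    ∑ i ∈ J, lam i * volume (cube i) ≤ B * testNConst n * ENNReal.ofReal (r ^ n) := by
  set F : CubeIdx n → Set (Pt n) := fun i => cube i ∩ {p | (lam i : ℝ≥0∞) ≤ densV E v p}
  have hF : ∀ i, MeasurableSet (F i) := fun i =>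
    (measurableSet_cube i).inter (measurableSet_le measurable_const (measurable_densV hE v))
  have hFQ : ∀ i, F i ⊆ cube i := fun i => inter_subset_left
  obtain ⟨a, ha⟩ := exists_amplitudes hFQ hlam fun _ => 1
  have ha' : ∀ i ∈ J, (a i : ℝ≥0∞) ^ 2 * volume (F i) = volume (cube i) := fun i hi => by
    simpa using ha i hi
  have h1 := normN_testFun_sq_le hn hv hF hFQ ha' hr hJ
  have h2 : normN (testFun J F a v) ≠ ⊤ := by
    intro h
    rw [h, ENNReal.top_pow two_ne_zero, top_le_iff] at h1
    exact ENNReal.mul_ne_top (testNConst_ne_top n) ENNReal.ofReal_ne_top h1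
  have h3 := le_normL2_mult_testFun hn hE hF hFQ (fun i _ p hp => hp.2) ha
  calc ∑ i ∈ J, lam i * volume (cube i)
      = ∑ i ∈ J, lam i * (((1 : ℝ≥0) : ℝ≥0∞) * volume (cube i)) := by simp
    _ ≤ normL2 (-1) (mult E (testFun J F a v)) ^ 2 := h3
    _ ≤ B * normN (testFun J F a v) ^ 2 := hB _ (stronglyMeasurable_testFun hF) h2
    _ ≤ B * (testNConst n * ENNReal.ofReal (r ^ n)) := by gcongr; exact h1
    _ = _ := by ring

/-- The constant of the lower bound by testing on `L_2(t)`. -/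
def testCConst (n : ℕ) : ℝ≥0∞ :=
  2 * ENNReal.ofReal (18 ^ n) ^ 2 * (unitVol n)⁻¹ * (cellConst n)⁻¹ ^ 2

lemma testCConst_ne_top (hn : 1 ≤ n) : testCConst n ≠ ⊤ :=
  ENNReal.mul_ne_top (ENNReal.mul_ne_top (ENNReal.mul_ne_top (by simp)
    (ENNReal.pow_ne_top ENNReal.ofReal_ne_top)) (ENNReal.inv_ne_top.2 (unitVol_ne_zero n)))
    (ENNReal.pow_ne_top (ENNReal.inv_ne_top.2 (cellConst_ne_zero hn)))

/-- The sum `S` enters linearly in the squared norm of the test function and quadratically in that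
of its image, so one factor `S` cancels. -/
lemma sum_le_of_bounded_C (hn : 1 ≤ n) {E : Pt n → (Val n m →L[ℂ] Val n m)}
    (hE : StronglyMeasurable E) {v : Val n m} (hv : ‖v‖ₑ = 1) {B : ℝ≥0∞}
    (hB : ∀ f : Pt n → Val n m, StronglyMeasurable f → normL2 1 f ≠ ⊤ →
      normC (mult E f) ^ 2 ≤ B * normL2 1 f ^ 2)
    {x : EuclideanSpace ℝ (Fin n)} {r : ℝ} (hr : 0 < r) {J : Finset (CubeIdx n)}
    (hJ : ∀ i ∈ J, cube i ⊆ tent x (17 * r)) {lam : CubeIdx n → ℝ≥0}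
    (hlam : ∀ i ∈ J, volume (cube i ∩ {p | (lam i : ℝ≥0∞) ≤ densV E v p}) ≠ 0) :
    ∑ i ∈ J, lam i * volume (cube i) ≤ B * testCConst n * ENNReal.ofReal (r ^ n) := by
  set F : CubeIdx n → Set (Pt n) := fun i => cube i ∩ {p | (lam i : ℝ≥0∞) ≤ densV E v p}
  have hF : ∀ i, MeasurableSet (F i) := fun i =>
    (measurableSet_cube i).inter (measurableSet_le measurable_const (measurable_densV hE v))
  have hFQ : ∀ i, F i ⊆ cube i := fun i => inter_subset_left
  set β : CubeIdx n → ℝ≥0 := fun i => lam i / (scale i).toNNReal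
  have hβ : ∀ i ∈ J, ENNReal.ofReal (scale i) * β i = lam i := by
    intro i _
    have : (scale i).toNNReal ≠ 0 := (Real.toNNReal_pos.2 (scale_pos i)).ne'
    rw [ENNReal.ofReal, ← ENNReal.coe_mul]
    simp only [β]
    rw [mul_div_cancel₀ _ this]
  obtain ⟨a, ha⟩ := exists_amplitudes hFQ hlam β
  set S := ∑ i ∈ J, (lam i : ℝ≥0∞) * volume (cube i) with hS_def
  -- Finiteness of `J` and of the levels is what permits the final cancellation of `S`.
  have hS : S ≠ ⊤ := ENNReal.sum_ne_top.2 fun i _ =>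
    ENNReal.mul_ne_top ENNReal.coe_ne_top (volume_cube_ne_top i)
  rcases eq_or_ne S 0 with hS0 | hS0
  · rw [hS0]; exact bot_le
  have h1 : normL2 1 (testFun J F a v) ^ 2 ≤ 2 * S := by
    refine (normL2_testFun_le hn hv hF hFQ ha).trans (le_of_eq ?_)
    rw [← Finset.mul_sum]
    congr 1
    refine Finset.sum_congr rfl fun i hi => ?_
    rw [← mul_assoc, hβ i hi]
  have h2 : normL2 1 (testFun J F a v) ≠ ⊤ := by
    intro h
    rw [h, ENNReal.top_pow two_ne_zero, top_le_iff] at h1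
    exact ENNReal.mul_ne_top (by simp) hS h1
  have h3 := le_normC_mult_testFun hn hF hFQ (fun i _ p hp => hp.2) ha hβ hr hJ (E := E) (v := v)
  have h4 := (h3.trans (hB _ (stronglyMeasurable_testFun hF) h2)).trans
    (mul_le_mul_right h1 B)
  set ρ := ENNReal.ofReal (r ^ n)
  have hρ : ρ ≠ 0 := ofReal_pow_ne_zero hr n
  have hρ' : ρ ≠ ⊤ := ENNReal.ofReal_ne_top
  set e := ENNReal.ofReal (18 ^ n)
  have he : e ≠ 0 := ofReal_pow_ne_zero (by norm_num) n
  have he' : e ≠ ⊤ := ENNReal.ofReal_ne_top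
  have hω := unitVol_ne_zero n
  have hω' := unitVol_ne_top n
  have hc := cellConst_ne_zero hn
  have hc' : cellConst n ≠ ⊤ := ENNReal.ofReal_ne_top
  have h5 : ENNReal.ofReal ((18 * r) ^ n) = e * ρ := by
    rw [mul_pow, ENNReal.ofReal_mul (by positivity)]
  rw [h5, ENNReal.mul_inv (Or.inl he) (Or.inl he')] at h4
  have h6 : S * S ≤ B * testCConst n * ρ * S := by
    calc S * S = (e * e⁻¹) ^ 2 * (ρ * ρ⁻¹) * (cellConst n * (cellConst n)⁻¹) ^ 2 *
          (unitVol n * (unitVol n)⁻¹) * (S * S) * (ρ * ρ⁻¹) := by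
          rw [ENNReal.mul_inv_cancel he he', ENNReal.mul_inv_cancel hρ hρ',
            ENNReal.mul_inv_cancel hc hc', ENNReal.mul_inv_cancel hω hω']
          simp
      _ = (e⁻¹ * ρ⁻¹ * (cellConst n * S)) ^ 2 * (ρ * unitVol n) *
          (e ^ 2 * ρ * (cellConst n)⁻¹ ^ 2 * (unitVol n)⁻¹) := by ring
      _ ≤ B * (2 * S) * (e ^ 2 * ρ * (cellConst n)⁻¹ ^ 2 * (unitVol n)⁻¹) := by gcongr
      _ = _ := by rw [testCConst]; ring
  exact (ENNReal.mul_le_mul_iff_left hS0 hS).1 h6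

/-! ### Lower bounds for the operator norms -/

lemma opNorm_le_sum_single (T : Val n m →L[ℂ] Val n m) :
    ‖T‖ ≤ ∑ j, ‖T (EuclideanSpace.single j 1)‖ := by
  refine T.opNorm_le_bound (Finset.sum_nonneg fun _ _ => norm_nonneg _) fun v => ?_
  have hv : v = ∑ j, v j • (EuclideanSpace.single j (1 : ℂ) : Val n m) := by
    have := (EuclideanSpace.basisFun (Fin ((1 + n) * m)) ℂ).sum_repr v
    simpa using this.symm
  calc ‖T v‖ = ‖∑ j, v j • T (EuclideanSpace.single j (1 : ℂ))‖ := by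
        conv_lhs => rw [hv]
        simp
    _ ≤ ∑ j, ‖v j • T (EuclideanSpace.single j (1 : ℂ))‖ := norm_sum_le _ _
    _ ≤ ∑ j, ‖T (EuclideanSpace.single j 1)‖ * ‖v‖ := by
        refine Finset.sum_le_sum fun j _ => ?_
        rw [norm_smul, mul_comm]
        gcongr
        exact PiLp.norm_apply_le v j
    _ = _ := (Finset.sum_mul _ _ _).symm

/-- Finite dimension replaces the operator norm by the columns of `E`, so test functions of one
fixed direction `v` are enough and no measurable choice of maximising vectors is made. -/
lemma dens_le_sum (E : Pt n → (Val n m →L[ℂ] Val n m)) {p : Pt n} (hp : 0 < p.1) :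
    dens E p ≤ (((1 + n) * m : ℕ) : ℝ≥0∞) *
      ∑ j, densV E (EuclideanSpace.single j 1) p := by
  have h1 : ‖E p‖ ^ 2 ≤ ((1 + n) * m : ℕ) * ∑ j, ‖E p (EuclideanSpace.single j 1)‖ ^ 2 := by
    calc ‖E p‖ ^ 2 ≤ (∑ j, ‖E p (EuclideanSpace.single j 1)‖) ^ 2 := by
          gcongr; exact opNorm_le_sum_single _
      _ ≤ _ := by
          have := sq_sum_le_card_mul_sum_sq (s := Finset.univ)
            (f := fun j : Fin ((1 + n) * m) => ‖E p (EuclideanSpace.single j 1)‖)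
          simpa using this
  have h2 : ∀ j : Fin ((1 + n) * m), densV E (EuclideanSpace.single j 1) p =
      ENNReal.ofReal (‖E p (EuclideanSpace.single j 1)‖ ^ 2 / p.1) := fun j =>
    Real.enorm_of_nonneg (by positivity)
  simp_rw [h2]
  rw [dens, Real.enorm_of_nonneg (by positivity),
    ← ENNReal.ofReal_sum_of_nonneg (fun j _ => by positivity), ← ENNReal.ofReal_natCast,
    ← ENNReal.ofReal_mul (by positivity)]
  apply ENNReal.ofReal_le_ofReal
  rw [← Finset.sum_div, ← mul_div_assoc]
  gcongr

lemma essSup_dens_le_sum (E : Pt n → (Val n m →L[ℂ] Val n m)) (q : Pt n) :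
    essSup (dens E) (volume.restrict (whitney q)) ≤ (((1 + n) * m : ℕ) : ℝ≥0∞) *
      ∑ j, essSup (densV E (EuclideanSpace.single j 1)) (volume.restrict (whitney q)) := by
  refine essSup_le_of_ae_le _ ?_
  have h : ∀ᵐ p ∂(volume.restrict (whitney q)), ∀ j : Fin ((1 + n) * m),
      densV E (EuclideanSpace.single j 1) p ≤
        essSup (densV E (EuclideanSpace.single j 1)) (volume.restrict (whitney q)) :=
    ae_all_iff.2 fun j => ENNReal.ae_le_essSup _
  filter_upwards [h, ae_restrict_mem (measurableSet_whitney q)] with p hp hpq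
  refine (dens_le_sum E (pos_of_mem_whitney' hpq)).trans ?_
  gcongr with j
  exact hp j

lemma eLpNorm_carlesonFun_le {g : Pt n → ℝ≥0∞} {A : ℝ≥0∞}
    (h : ∀ x r, 0 < r → ∫⁻ p in tent x r, g p ≤ A * ENNReal.ofReal (r ^ n)) :
    eLpNorm (carlesonFun g) ⊤ volume ≤ A := by
  rw [eLpNorm_exponent_top]
  refine essSup_le_of_ae_le _ (Eventually.of_forall fun x => ?_)
  change carlesonFun g x ≤ A
  rw [carlesonFun_eq]
  refine iSup₂_le fun r hr => ?_
  rw [mul_comm, ← div_eq_mul_inv, ENNReal.div_le_iff (ofReal_pow_ne_zero hr n)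
    ENNReal.ofReal_ne_top]
  exact h x r hr

/-- The constant relating the Carleson-Dahlberg norm to sums over grid cells. -/
def gridConst (n m : ℕ) : ℝ≥0∞ := (((1 + n) * m : ℕ) : ℝ≥0∞) ^ 2 * (nearConst n * 2)

lemma gridConst_ne_top (n m : ℕ) : gridConst n m ≠ ⊤ :=
  ENNReal.mul_ne_top (ENNReal.pow_ne_top (ENNReal.natCast_ne_top _))
    (ENNReal.mul_ne_top (nearConst_ne_top n) (by simp))

/-- Reduction of (iii) to testing. In `gridConst` one dimension factor comes from Cauchy-Schwarz
over the columns, the other from summing the columns, and the `2` from halving the levels. -/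
lemma carlesonDahlberg_sq_le (hn : 1 ≤ n) {E : Pt n → (Val n m →L[ℂ] Val n m)}
    (hE : StronglyMeasurable E) {A : ℝ≥0∞}
    (h : ∀ v : Val n m, ‖v‖ₑ = 1 → ∀ (x : EuclideanSpace ℝ (Fin n)) (r : ℝ), 0 < r →
      ∀ J : Finset (CubeIdx n), (∀ i ∈ J, cube i ⊆ tent x (17 * r)) →
      ∀ lam : CubeIdx n → ℝ≥0,
        (∀ i ∈ J, volume (cube i ∩ {p | (lam i : ℝ≥0∞) ≤ densV E v p}) ≠ 0) →
        ∑ i ∈ J, lam i * volume (cube i) ≤ A * ENNReal.ofReal (r ^ n)) :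
    carlesonDahlberg E ^ 2 ≤ gridConst n m * A := by
  rw [carlesonDahlberg_sq]
  refine eLpNorm_carlesonFun_le fun x r hr => ?_
  have hj : ∀ j : Fin ((1 + n) * m), ∫⁻ q in tent x r,
      essSup (densV E (EuclideanSpace.single j 1)) (volume.restrict (whitney q)) ≤
        nearConst n * (2 * (A * ENNReal.ofReal (r ^ n))) := by
    intro j
    have hv : ‖(EuclideanSpace.single j (1 : ℂ) : Val n m)‖ₑ = 1 := by
      rw [← ofReal_norm]; simp
    exact lintegral_tent_essSup_le hn fun J hJ =>
      sum_essSup_le hn (measurable_densV hE _) J fun lam hlam => h _ hv x r hr J hJ lam hlam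
  change ∫⁻ q in tent x r, essSup (dens E) (volume.restrict (whitney q)) ≤ _
  calc _ ≤ ∫⁻ q in tent x r, (((1 + n) * m : ℕ) : ℝ≥0∞) * ∑ j,
        essSup (densV E (EuclideanSpace.single j 1)) (volume.restrict (whitney q)) :=
        lintegral_mono fun q => essSup_dens_le_sum E q
    _ = (((1 + n) * m : ℕ) : ℝ≥0∞) * ∑ j, ∫⁻ q in tent x r,
        essSup (densV E (EuclideanSpace.single j 1)) (volume.restrict (whitney q)) := by
        rw [lintegral_const_mul' _ _ (ENNReal.natCast_ne_top _), lintegral_finsetSum _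
          fun j _ => measurable_essSup_whitney (measurable_densV hE _)]
    _ ≤ (((1 + n) * m : ℕ) : ℝ≥0∞) * ∑ _j : Fin ((1 + n) * m),
        nearConst n * (2 * (A * ENNReal.ofReal (r ^ n))) := by
        gcongr with j
        exact hj j
    _ = _ := by
        rw [Finset.sum_const, Finset.card_univ, Fintype.card_fin, nsmul_eq_mul, gridConst]
        ring

/-! ### Invariance and homogeneity of the norms -/

/-- A functional on functions that depends only on the class of the function almost everywhere
on the half space, is positively homogeneous, and so vanishes at zero. -/
structure IsGauge (ν : (Pt n → Val n m) → ℝ≥0∞) : Prop where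
  congr : ∀ f g, f =ᵐ[halfVol n] g → ν f = ν g
  smul : ∀ (c : ℝ≥0) f, ν (fun p => ((c : ℝ) : ℂ) • f p) = c * ν f

lemma IsGauge.zero {ν : (Pt n → Val n m) → ℝ≥0∞} (h : IsGauge ν) {f : Pt n → Val n m}
    (hf : f =ᵐ[halfVol n] 0) : ν f = 0 := by
  have h1 := h.smul 0 f
  rw [ENNReal.coe_zero, zero_mul] at h1
  rw [← h1]
  refine h.congr _ _ (hf.trans (Eventually.of_forall fun p => ?_))
  simp

lemma whitneyTwo_smul (c : ℝ≥0) (f : Pt n → Val n m) :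
    whitneyTwo (fun p => ((c : ℝ) : ℂ) • f p) = fun q => c * whitneyTwo f q := by
  funext q
  have h : (whitneyTwo (fun p => ((c : ℝ) : ℂ) • f p) q) ^ 2 = (c * whitneyTwo f q) ^ 2 := by
    rw [mul_pow, whitneyTwo_sq, whitneyTwo_sq, whitneyAvg, whitneyAvg]
    simp_rw [enorm_real_smul, mul_pow]
    rw [lintegral_const_mul' _ _ (ENNReal.pow_ne_top ENNReal.coe_ne_top), mul_left_comm]
  exact (ENNReal.pow_right_strictMono two_ne_zero).injective h

lemma eLpNorm_two_const_mul {α : Type*} [MeasurableSpace α] {μ : Measure α} (c : ℝ≥0)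
    (g : α → ℝ≥0∞) : eLpNorm (fun x => (c : ℝ≥0∞) * g x) 2 μ = c * eLpNorm g 2 μ := by
  refine (ENNReal.pow_right_strictMono two_ne_zero).injective ?_
  rw [mul_pow, eLpNorm_two_sq, eLpNorm_two_sq,
    ← lintegral_const_mul' _ _ (ENNReal.pow_ne_top ENNReal.coe_ne_top)]
  simp_rw [enorm_eq_self, mul_pow]

lemma isGauge_normN : IsGauge (normN (n := n) (m := m)) where
  congr f g h := by rw [normN, normN, whitneyTwo_congr h]
  smul c f := by
    rw [normN, normN, whitneyTwo_smul, ← eLpNorm_two_const_mul]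
    congr 1
    funext x
    simp_rw [nonTangMax, ENNReal.mul_iSup]

lemma isGauge_normC : IsGauge (normC (n := n) (m := m)) where
  congr f g h := by rw [normC, normC, whitneyTwo_congr h]
  smul c f := by
    rw [normC, normC, whitneyTwo_smul, ← eLpNorm_two_const_mul]
    congr 1
    funext x
    simp_rw [carlesonFun, ENNReal.mul_iSup, lintegral_const_mul' _ _ ENNReal.coe_ne_top,
      mul_left_comm]

lemma isGauge_normA : IsGauge (normA (n := n) (m := m)) where
  congr f g h := by rw [normA, normA, whitneyTwo_congr h]
  smul c f := by
    rw [normA, normA, whitneyTwo_smul, ← eLpNorm_two_const_mul]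
    congr 1
    funext x
    simp_rw [areaFun, mul_assoc, lintegral_const_mul' _ _ ENNReal.coe_ne_top]

lemma isGauge_normL2 (α : ℝ) : IsGauge (normL2 (n := n) (m := m) α) where
  congr f g h := by
    rw [normL2, normL2]
    congr 1
    refine lintegral_congr_ae ?_
    filter_upwards [h] with p hp
    rw [hp]
  smul c f := by
    refine (ENNReal.pow_right_strictMono two_ne_zero).injective ?_
    beta_reduce
    rw [mul_pow, normL2_sq, normL2_sq,
      ← lintegral_const_mul' _ _ (ENNReal.pow_ne_top ENNReal.coe_ne_top)]
    simp_rw [enorm_real_smul, mul_pow, mul_assoc]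

lemma mult_congr {E E' : Pt n → (Val n m →L[ℂ] Val n m)} {f f' : Pt n → Val n m}
    (hE : E =ᵐ[halfVol n] E') (hf : f =ᵐ[halfVol n] f') :
    mult E f =ᵐ[halfVol n] mult E' f' := by
  filter_upwards [hE, hf] with p h1 h2
  rw [mult, mult, h1, h2]

lemma aestronglyMeasurable_mult {E : Pt n → (Val n m →L[ℂ] Val n m)}
    (hE : AEStronglyMeasurable E (halfVol n)) {f : Pt n → Val n m}
    (hf : AEStronglyMeasurable f (halfVol n)) : AEStronglyMeasurable (mult E f) (halfVol n) :=
  ⟨_, stronglyMeasurable_mult hE.stronglyMeasurable_mk hf.stronglyMeasurable_mk,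
    mult_congr hE.ae_eq_mk hf.ae_eq_mk⟩

lemma carlesonDahlberg_congr {E E' : Pt n → (Val n m →L[ℂ] Val n m)}
    (h : E =ᵐ[halfVol n] E') : carlesonDahlberg E = carlesonDahlberg E' := by
  have : (fun p : Pt n => ‖E p‖ ^ 2 / p.1) =ᵐ[halfVol n] fun p => ‖E' p‖ ^ 2 / p.1 := by
    filter_upwards [h] with p hp
    rw [hp]
  rw [carlesonDahlberg, carlesonDahlberg, whitneySup_congr this]

/-- A nonzero Whitney average at one point makes the maximal function nonzero on its whole shadow,
which has positive measure. So all Whitney averages vanish, and they control the integral of `|f|²`.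
-/
lemma ae_eq_zero_of_normN {f : Pt n → Val n m} (hf : AEStronglyMeasurable f (halfVol n))
    (h : normN f = 0) : f =ᵐ[halfVol n] 0 := by
  set g := hf.mk f
  have hg : StronglyMeasurable g := hf.stronglyMeasurable_mk
  have hgN : normN g = 0 := by rw [← h, isGauge_normN.congr _ _ hf.ae_eq_mk]
  refine hf.ae_eq_mk.trans ?_
  have h1 : ∫⁻ x, nonTangMax (whitneyTwo g) x ^ 2 = 0 := by
    rw [← normN_sq, hgN]; simp
  rw [lintegral_eq_zero_iff ((measurable_nonTangMax _).pow_const 2)] at h1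
  have h2 : ∀ q : Pt n, whitneyTwo g q ^ 2 = 0 := by
    intro q
    rcases le_or_gt q.1 0 with hq | hq
    · rw [whitneyTwo_sq, whitneyAvg_of_nonpos _ hq]
    by_contra hne
    have hsub : ball q.2 q.1 ⊆ {x | ¬ nonTangMax (whitneyTwo g) x ^ 2 = 0} := by
      intro x hx hx0
      rw [mem_ball, dist_comm, dist_eq_norm] at hx
      apply hne
      refine le_antisymm (le_trans (pow_le_pow_left' (le_nonTangMax _ hx) 2) hx0.le) bot_le
    exact (measure_ball_pos volume q.2 hq).ne' (measure_mono_null hsub (ae_iff.1 h1))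
  have h3 : ∫⁻ p, ‖g p‖ₑ ^ 2 ∂(halfVol n) = 0 := by
    refine le_antisymm
      ((lintegral_le_lintegral_whitneyAvg (hg.enorm.pow_const 2)).trans ?_) bot_le
    simp_rw [← whitneyTwo_sq, h2]
    simp
  rw [lintegral_eq_zero_iff (hg.enorm.pow_const 2)] at h3
  filter_upwards [h3] with p hp
  simpa using hp

lemma ae_eq_zero_of_normL2 {f : Pt n → Val n m} (hf : AEStronglyMeasurable f (halfVol n))
    {α : ℝ} (h : normL2 α f = 0) : f =ᵐ[halfVol n] 0 := by
  have h1 : ∫⁻ p, ‖f p‖ₑ ^ 2 * ENNReal.ofReal (p.1 ^ α) ∂(halfVol n) = 0 := by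
    rw [← normL2_sq, h]; simp
  have hm : AEMeasurable (fun p : Pt n => ‖f p‖ₑ ^ 2 * ENNReal.ofReal (p.1 ^ α)) (halfVol n) :=
    (hf.enorm.pow_const 2).mul (by fun_prop)
  rw [lintegral_eq_zero_iff' hm] at h1
  filter_upwards [h1, ae_restrict_mem (measurableSet_halfSpace n)] with p hp hp0
  have hp0 : 0 < p.1 := hp0
  have : ENNReal.ofReal (p.1 ^ α) ≠ 0 := by
    simpa using Real.rpow_pos_of_pos hp0 α
  simpa [this] using hp

/-- Normalisation handles nonzero `ν f`. The supremum does not see functions with `ν f = 0`, and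
`h0` makes these vanish almost everywhere. -/
lemma le_opNorm_mul {ν ν' : (Pt n → Val n m) → ℝ≥0∞} (hν : IsGauge ν) (hν' : IsGauge ν')
    (h0 : ∀ f, AEStronglyMeasurable f (halfVol n) → ν f = 0 → f =ᵐ[halfVol n] 0)
    (E : Pt n → (Val n m →L[ℂ] Val n m)) {f : Pt n → Val n m} (hf : MemSpace ν f) :
    ν' (mult E f) ≤ opNorm ν ν' E * ν f := by
  rcases eq_or_ne (ν f) 0 with hz | hz
  · have h1 : mult E f =ᵐ[halfVol n] 0 := by
      filter_upwards [h0 f hf.1 hz] with p hp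
      simp [mult, hp]
    rw [hν'.zero h1]
    exact bot_le
  have hfin : ν f ≠ ⊤ := hf.2.ne
  set c : ℝ≥0 := (ν f).toNNReal⁻¹
  have hc : (c : ℝ≥0∞) = (ν f)⁻¹ := by
    have : (ν f).toNNReal ≠ 0 := by simp [ENNReal.toNNReal_eq_zero_iff, hz, hfin]
    simp only [c]
    rw [ENNReal.coe_inv this, ENNReal.coe_toNNReal hfin]
  set g : Pt n → Val n m := fun p => ((c : ℝ) : ℂ) • f p
  have hg1 : ν g = 1 := by
    rw [hν.smul, hc, ENNReal.inv_mul_cancel hz hfin]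
  have hg : MemSpace ν g := ⟨hf.1.const_smul ((c : ℝ) : ℂ), by rw [hg1]; exact ENNReal.one_lt_top⟩
  have h1 : ν' (mult E g) ≤ opNorm ν ν' E :=
    le_iSup₂ (f := fun (f : Pt n → Val n m) (_ : MemSpace ν f ∧ ν f = 1) => ν' (mult E f))
      g ⟨hg, hg1⟩
  have h2 : mult E g = fun p => ((c : ℝ) : ℂ) • mult E f p := by
    funext p
    simp [mult, g]
  rw [h2, hν'.smul, hc, mul_comm, ← div_eq_mul_inv, ENNReal.div_le_iff hz hfin] at h1
  exact h1

lemma opNorm_le_of_bound {ν ν' : (Pt n → Val n m) → ℝ≥0∞}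
    {E : Pt n → (Val n m →L[ℂ] Val n m)} {K : ℝ≥0∞}
    (h : ∀ f, MemSpace ν f → ν' (mult E f) ≤ K * ν f) : opNorm ν ν' E ≤ K :=
  iSup₂_le fun f hf => by simpa [hf.2] using h f hf.1

lemma opNorm_congr {ν ν' : (Pt n → Val n m) → ℝ≥0∞} (hν' : IsGauge ν')
    {E E' : Pt n → (Val n m →L[ℂ] Val n m)} (h : E =ᵐ[halfVol n] E') :
    opNorm ν ν' E = opNorm ν ν' E' := by
  unfold opNorm
  simp_rw [fun f => hν'.congr _ _ (mult_congr h (EventuallyEq.refl _ f))]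

/-! ### The comparisons -/

lemma le_of_sq_le {a b u : ℝ≥0∞} {c : ℝ≥0} (hc : u ≤ (c : ℝ≥0∞) ^ 2) (h : a ^ 2 ≤ u * b ^ 2) :
    a ≤ c * b := by
  rw [← ENNReal.pow_le_pow_left_iff two_ne_zero, mul_pow]
  exact h.trans (by gcongr)

/-- All quantities depend only on the almost everywhere class of `E` on the half space, so the
testing argument is run on a strongly measurable representative. -/
theorem carlesonDahlberg_le_opNorm_N (hn : 1 ≤ n) {c : ℝ≥0}
    (hc : gridConst n m * testNConst n ≤ (c : ℝ≥0∞) ^ 2) {E : Pt n → (Val n m →L[ℂ] Val n m)}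
    (hE : AEStronglyMeasurable E (halfVol n)) :
    carlesonDahlberg E ≤ c * opNorm normN (normL2 (-1)) E := by
  rw [carlesonDahlberg_congr hE.ae_eq_mk, opNorm_congr (isGauge_normL2 _) hE.ae_eq_mk]
  have hm := hE.stronglyMeasurable_mk
  set B := opNorm normN (normL2 (-1)) (hE.mk E)
  refine le_of_sq_le hc ?_
  have h := carlesonDahlberg_sq_le hn hm (A := B ^ 2 * testNConst n) fun v hv x r hr J hJ lam hl =>
    sum_le_of_bounded_N hn hm hv (fun f hf hfin => by
      rw [← mul_pow]
      exact pow_le_pow_left' (le_opNorm_mul isGauge_normN (isGauge_normL2 _)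
        (fun f => ae_eq_zero_of_normN) _ ⟨hf.aestronglyMeasurable, hfin.lt_top⟩) 2) hr hJ hl
  exact h.trans (le_of_eq (by ring))

theorem carlesonDahlberg_le_opNorm_C (hn : 1 ≤ n) {c : ℝ≥0}
    (hc : gridConst n m * testCConst n ≤ (c : ℝ≥0∞) ^ 2) {E : Pt n → (Val n m →L[ℂ] Val n m)}
    (hE : AEStronglyMeasurable E (halfVol n)) :
    carlesonDahlberg E ≤ c * opNorm (normL2 1) normC E := by
  rw [carlesonDahlberg_congr hE.ae_eq_mk, opNorm_congr isGauge_normC hE.ae_eq_mk]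
  have hm := hE.stronglyMeasurable_mk
  set B := opNorm (normL2 1) normC (hE.mk E)
  refine le_of_sq_le hc ?_
  have h := carlesonDahlberg_sq_le hn hm (A := B ^ 2 * testCConst n) fun v hv x r hr J hJ lam hl =>
    sum_le_of_bounded_C hn hm hv (fun f hf hfin => by
      rw [← mul_pow]
      exact pow_le_pow_left' (le_opNorm_mul (isGauge_normL2 _) isGauge_normC
        (fun f hf => ae_eq_zero_of_normL2 hf) _ ⟨hf.aestronglyMeasurable, hfin.lt_top⟩) 2)
        hr hJ hl
  exact h.trans (le_of_eq (by ring))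

theorem normL2_mult_le (hn : 1 ≤ n) {c : ℝ≥0} (hc : upperN n ≤ (c : ℝ≥0∞) ^ 2)
    {E : Pt n → (Val n m →L[ℂ] Val n m)} (hE : AEStronglyMeasurable E (halfVol n))
    (hfin : carlesonDahlberg E ≠ ⊤) {f : Pt n → Val n m}
    (hf : AEStronglyMeasurable f (halfVol n)) :
    normL2 (-1) (mult E f) ≤ c * carlesonDahlberg E * normN f := by
  rw [(isGauge_normL2 (-1)).congr _ _ (mult_congr hE.ae_eq_mk hf.ae_eq_mk),
    isGauge_normN.congr _ _ hf.ae_eq_mk, carlesonDahlberg_congr hE.ae_eq_mk, mul_assoc]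
  rw [carlesonDahlberg_congr hE.ae_eq_mk] at hfin
  refine le_of_sq_le hc ?_
  rw [mul_pow, ← mul_assoc]
  exact normL2_mult_sq_le hn hE.stronglyMeasurable_mk hfin hf.stronglyMeasurable_mk

theorem normA_mult_le (hn : 1 ≤ n) {c : ℝ≥0} (hc : upperA n ≤ (c : ℝ≥0∞) ^ 2)
    {E : Pt n → (Val n m →L[ℂ] Val n m)} (hE : AEStronglyMeasurable E (halfVol n))
    (hfin : carlesonDahlberg E ≠ ⊤) {f : Pt n → Val n m}
    (hf : AEStronglyMeasurable f (halfVol n)) :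
    normA (mult E f) ≤ c * carlesonDahlberg E * normL2 1 f := by
  rw [isGauge_normA.congr _ _ (mult_congr hE.ae_eq_mk hf.ae_eq_mk),
    (isGauge_normL2 1).congr _ _ hf.ae_eq_mk, carlesonDahlberg_congr hE.ae_eq_mk, mul_assoc]
  rw [carlesonDahlberg_congr hE.ae_eq_mk] at hfin
  refine le_of_sq_le hc ?_
  rw [mul_pow, ← mul_assoc]
  exact normA_mult_sq_le hn hE.stronglyMeasurable_mk hfin hf.stronglyMeasurable_mk

theorem normC_le_normA (hn : 1 ≤ n) {c : ℝ≥0} (hc : areaConst n ≤ (c : ℝ≥0∞) ^ 2)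
    {f : Pt n → Val n m} (hf : AEStronglyMeasurable f (halfVol n)) :
    normC f ≤ c * normA f := by
  rw [isGauge_normC.congr _ _ hf.ae_eq_mk, isGauge_normA.congr _ _ hf.ae_eq_mk]
  exact le_of_sq_le hc (normC_sq_le hn hf.stronglyMeasurable_mk)

lemma exists_const (hn : 1 ≤ n) (m : ℕ) : ∃ c : ℝ≥0, 1 ≤ c ∧
    gridConst n m * testNConst n ≤ (c : ℝ≥0∞) ^ 2 ∧
    gridConst n m * testCConst n ≤ (c : ℝ≥0∞) ^ 2 ∧ upperN n ≤ (c : ℝ≥0∞) ^ 2 ∧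
    upperA n ≤ (c : ℝ≥0∞) ^ 2 ∧ areaConst n ≤ (c : ℝ≥0∞) ^ 2 := by
  set S := gridConst n m * testNConst n + gridConst n m * testCConst n + upperN n + upperA n +
    areaConst n
  have hS : S ≠ ⊤ := by
    simp only [S, ne_eq, ENNReal.add_eq_top, not_or]
    exact ⟨⟨⟨⟨ENNReal.mul_ne_top (gridConst_ne_top n m) (testNConst_ne_top n),
      ENNReal.mul_ne_top (gridConst_ne_top n m) (testCConst_ne_top hn)⟩, upperN_ne_top n⟩,
      upperA_ne_top n⟩, areaConst_ne_top n⟩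
  have hle : S ≤ ((1 + S.toNNReal : ℝ≥0) : ℝ≥0∞) ^ 2 := by
    rw [ENNReal.coe_add, ENNReal.coe_one, ENNReal.coe_toNNReal hS]
    calc S ≤ 1 + S := le_add_self
      _ ≤ (1 + S) ^ 2 := le_self_pow₀ le_self_add two_ne_zero
  refine ⟨1 + S.toNNReal, le_self_add, ?_, ?_, ?_, ?_, ?_⟩ <;> refine le_trans ?_ hle <;>
    simp only [S]
  · exact le_self_add.trans (le_self_add.trans (le_self_add.trans le_self_add))
  · exact le_add_self.trans (le_self_add.trans (le_self_add.trans le_self_add))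
  · exact le_add_self.trans (le_self_add.trans le_self_add)
  · exact le_add_self.trans le_self_add
  · exact le_add_self

lemma IsBoundedMult.opNorm_lt_top {ν ν' : (Pt n → Val n m) → ℝ≥0∞}
    {E : Pt n → (Val n m →L[ℂ] Val n m)} (h : IsBoundedMult ν ν' E) : opNorm ν ν' E < ⊤ := by
  obtain ⟨K, hK⟩ := h
  exact (opNorm_le_of_bound fun f hf => (hK f hf).2).trans_lt ENNReal.coe_lt_top

lemma isBoundedMult_of_bound {ν ν' : (Pt n → Val n m) → ℝ≥0∞}
    {E : Pt n → (Val n m →L[ℂ] Val n m)} (hE : AEStronglyMeasurable E (halfVol n)) {K : ℝ≥0∞}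
    (hK : K ≠ ⊤) (h : ∀ f, MemSpace ν f → ν' (mult E f) ≤ K * ν f) : IsBoundedMult ν ν' E := by
  lift K to ℝ≥0 using hK
  exact ⟨K, fun f hf => ⟨⟨aestronglyMeasurable_mult hE hf.1,
    (h f hf).trans_lt (ENNReal.mul_lt_top ENNReal.coe_lt_top hf.2)⟩, h f hf⟩⟩

/-- Includes the case of infinite Carleson-Dahlberg norm, where `1 ≤ c` keeps the product from being
`0 * ⊤`. -/
lemma opNorm_le_mul_carlesonDahlberg {ν ν' : (Pt n → Val n m) → ℝ≥0∞}
    {E : Pt n → (Val n m →L[ℂ] Val n m)} {c : ℝ≥0} (hc : 1 ≤ c)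
    (h : carlesonDahlberg E ≠ ⊤ → ∀ f, MemSpace ν f →
      ν' (mult E f) ≤ c * carlesonDahlberg E * ν f) :
    opNorm ν ν' E ≤ c * carlesonDahlberg E := by
  rcases eq_or_ne (carlesonDahlberg E) ⊤ with htop | htop
  · rw [htop, ENNReal.mul_top (by simpa using (one_pos.trans_le hc).ne')]
    exact le_top
  · exact opNorm_le_of_bound (h htop)

end CarlesonMult

end

/-! ### The equivalences and the comparison of norms -/

theorem theorem2p4 (n m : ℕ) (hn : 1 ≤ n) (hm : 1 ≤ m) :
    (∀ E : CarlesonMult.Pt n → (CarlesonMult.Val n m →L[ℂ] CarlesonMult.Val n m),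
      AEStronglyMeasurable E (CarlesonMult.halfVol n) →
      List.TFAE [
        CarlesonMult.IsBoundedMult CarlesonMult.normN (CarlesonMult.normL2 (-1)) E,
        CarlesonMult.IsBoundedMult (CarlesonMult.normL2 1) CarlesonMult.normC E,
        CarlesonMult.IsBoundedMult (CarlesonMult.normL2 1) CarlesonMult.normA E,
        CarlesonMult.carlesonDahlberg E < ∞]) ∧
    ∃ K : ℝ≥0, ∀ E : CarlesonMult.Pt n → (CarlesonMult.Val n m →L[ℂ] CarlesonMult.Val n m),
      AEStronglyMeasurable E (CarlesonMult.halfVol n) →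
      CarlesonMult.Comparable K (CarlesonMult.carlesonDahlberg E)
        (CarlesonMult.opNorm CarlesonMult.normN (CarlesonMult.normL2 (-1)) E) ∧
      CarlesonMult.Comparable K
        (CarlesonMult.opNorm CarlesonMult.normN (CarlesonMult.normL2 (-1)) E)
        (CarlesonMult.opNorm (CarlesonMult.normL2 1) CarlesonMult.normC E) ∧
      CarlesonMult.Comparable K
        (CarlesonMult.opNorm CarlesonMult.normN (CarlesonMult.normL2 (-1)) E)
        (CarlesonMult.opNorm (CarlesonMult.normL2 1) CarlesonMult.normA E) := by
  obtain ⟨c, hc1, hcN, hcC, hcU, hcA, hcR⟩ := CarlesonMult.exists_const hn m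
  -- Each basic inequality costs a factor `c`, and the longest chain has three of them: from the `C`
  -- operator norm to the `A` operator norm, to `‖E‖_*`, to the operator norm on `N_{2,2}`.
  refine ⟨fun E hE => ?_, c ^ 3, fun E hE => ?_⟩
  · tfae_have 1 → 4 := fun h =>
      (CarlesonMult.carlesonDahlberg_le_opNorm_N hn hcN hE).trans_lt
        (ENNReal.mul_lt_top ENNReal.coe_lt_top h.opNorm_lt_top)
    tfae_have 2 → 4 := fun h =>
      (CarlesonMult.carlesonDahlberg_le_opNorm_C hn hcC hE).trans_lt
        (ENNReal.mul_lt_top ENNReal.coe_lt_top h.opNorm_lt_top)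
    tfae_have 4 → 1 := fun h =>
      CarlesonMult.isBoundedMult_of_bound hE (ENNReal.mul_ne_top ENNReal.coe_ne_top h.ne)
        fun f hf => CarlesonMult.normL2_mult_le hn hcU hE h.ne hf.1
    tfae_have 4 → 3 := fun h =>
      CarlesonMult.isBoundedMult_of_bound hE (ENNReal.mul_ne_top ENNReal.coe_ne_top h.ne)
        fun f hf => CarlesonMult.normA_mult_le hn hcA hE h.ne hf.1
    -- Only the domination of `C` by `A` is needed; the return from 2 to 3 passes through 4.
    tfae_have 3 → 2 := fun ⟨K, hK⟩ =>
      CarlesonMult.isBoundedMult_of_bound hE (K := c * K)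
        (ENNReal.mul_ne_top ENNReal.coe_ne_top ENNReal.coe_ne_top) fun f hf => by
          rw [mul_assoc]
          refine (CarlesonMult.normC_le_normA hn hcR
            (CarlesonMult.aestronglyMeasurable_mult hE hf.1)).trans ?_
          gcongr
          exact (hK f hf).2
    tfae_finish
  · have h1 := CarlesonMult.carlesonDahlberg_le_opNorm_N hn hcN hE
    have h2 := CarlesonMult.carlesonDahlberg_le_opNorm_C hn hcC hE
    have h3 := CarlesonMult.opNorm_le_mul_carlesonDahlberg hc1 fun htop f hf =>
      CarlesonMult.normL2_mult_le hn hcU hE htop hf.1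
    have h4 := CarlesonMult.opNorm_le_mul_carlesonDahlberg hc1 fun htop f hf =>
      CarlesonMult.normA_mult_le hn hcA hE htop hf.1
    have h5 : CarlesonMult.opNorm (CarlesonMult.normL2 1) CarlesonMult.normC E ≤
        c * CarlesonMult.opNorm (CarlesonMult.normL2 1) CarlesonMult.normA E :=
      iSup₂_le fun f hf => by
        refine (CarlesonMult.normC_le_normA hn hcR
          (CarlesonMult.aestronglyMeasurable_mult hE hf.1.1)).trans ?_
        gcongr
        exact le_iSup₂ (f := fun (f : CarlesonMult.Pt n → CarlesonMult.Val n m)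
          (_ : CarlesonMult.MemSpace (CarlesonMult.normL2 1) f ∧ CarlesonMult.normL2 1 f = 1) =>
            CarlesonMult.normA (CarlesonMult.mult E f)) f hf
    generalize CarlesonMult.carlesonDahlberg E = D at *
    generalize CarlesonMult.opNorm CarlesonMult.normN (CarlesonMult.normL2 (-1)) E = N at *
    generalize CarlesonMult.opNorm (CarlesonMult.normL2 1) CarlesonMult.normC E = C at *
    generalize CarlesonMult.opNorm (CarlesonMult.normL2 1) CarlesonMult.normA E = A at *
    have hc' : (1 : ℝ≥0∞) ≤ c := by exact_mod_cast hc1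
    have hpow : ∀ k, k ≤ 3 → ∀ a b : ℝ≥0∞, a ≤ (c : ℝ≥0∞) ^ k * b →
        a ≤ ((c ^ 3 : ℝ≥0) : ℝ≥0∞) * b := fun k hk a b hab => by
      refine hab.trans ?_
      rw [ENNReal.coe_pow]
      gcongr
    have hDN : A ≤ (c : ℝ≥0∞) ^ 2 * N := by
      calc A ≤ c * D := h4
        _ ≤ c * (c * N) := by gcongr
        _ = _ := by ring
    have hNC : N ≤ (c : ℝ≥0∞) ^ 2 * C := by
      calc N ≤ c * D := h3
        _ ≤ c * (c * C) := by gcongr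
        _ = _ := by ring
    refine ⟨⟨hpow 1 (by norm_num) _ _ (by rwa [pow_one]),
      hpow 1 (by norm_num) _ _ (by rwa [pow_one])⟩,
      ⟨hpow 2 (by norm_num) _ _ hNC, hpow 3 le_rfl _ _ ?_⟩,
      ⟨hpow 3 le_rfl _ _ ?_, hpow 2 (by norm_num) _ _ hDN⟩⟩
    · calc C ≤ c * A := h5
        _ ≤ c * (c ^ 2 * N) := by gcongr
        _ = _ := by ring
    · calc N ≤ c ^ 2 * C := hNC
        _ ≤ c ^ 2 * (c * A) := by gcongr
        _ = _ := by ring
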